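/- **Setting.** Let $\mathcal G=(V,\mathcal I,\mathcal E,\partial)$ be a finite graph with internal edges $\mathcal I$ and external edges $\mathcal E$, each set being split into positive and negative edges, $\mathcal E=\mathcal E_+\dot\cup\mathcal E_-$, $\mathcal I=\mathcal I_+\dot\cup\mathcal I_-$. An internal edge $j$ is identified with $I_j=[0,a_j]$, $a_j>0$, an external edge with $I_j=[0,\infty)$; write $\underline a_\pm=\{a_j\}_{j\in\mathcal I_\pm}$. Let $\mathcal H=\bigoplus_{j\in\mathcal E\cup\mathcal I}L^2(I_j)$, and let $\mathcal D\subset\mathcal H$ be the set of all $\psi=(\psi_j)$ such that $\psi_j,\psi_j'$ are (locally) absolutely continuous on $I_j$ and $\psi_j''\in L^2(I_j)$. Put $(\tau\psi)_j=-\psi_j''$ on positive and $(\tau\psi)_j=+\psi_j''$ on negative edges. Let $\mathcal K=\mathcal K_+\oplus\mathcal K_-$, $\mathcal K_\pm=\mathbb C^{\mathcal E_\pm}\oplus\mathbb C^{\mathcal I_\pm}\oplus\mathbb C^{\mathcal I_\pm}$, $n=\dim\mathcal K_+$, $m=\dim\mathcal K_-$, and for $\psi\in\mathcal D$ let $$\underline\psi=\underline\psi_+\oplus\underline\psi_-,\qquad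 \underline\psi_\pm=\big(\{\psi_j(0)\}_{\mathcal E_\pm},\{\psi_j(0)\}_{\mathcal I_\pm},\{\psi_j(a_j)\}_{\mathcal I_\pm}\big),$$ $$\underline{\psi}'=\underline{\psi}'_+\oplus\underline{\psi}'_-,\qquad \underline{\psi}'_\pm=\big(\{\psi_j'(0)\}_{\mathcal E_\pm},\{\psi_j'(0)\}_{\mathcal I_\pm},\{-\psi_j'(a_j)\}_{\mathcal I_\pm}\big).$$ For linear maps $A,B$ in $\mathcal K$ let $T(A,B)$ be the operator $\psi\mapsto\tau\psi$ in $\mathcal H$ with domain $\{\psi\in\mathcal D: A\underline\psi+B\underline\psi'=0\}$. **Matrices.** For $l\in\{n,m\}$ put $\underline b=\underline a_+$, $(E_l,J_l)=(\mathcal E_+,\mathcal I_+)$ if $l=n$, and $\underline b=\underline a_-$, $(E_l,J_l)=(\mathcal E_-,\mathcal I_-)$ if $l=m$. With $e^{ik\underline b}=\operatorname{diag}(e^{ikb_j})$, define $$X_l(k)=\begin{bmatrix}1&0&0\\0&1&1\\0&e^{ik\underline b}&e^{-ik\underline b}\end{bmatrix},\quad Y_l(k)=ik\begin{bmatrix}1&0&0\\0&1&-1\\0&-e^{ik\underline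 b}&e^{-ik\underline b}\end{bmatrix},\quad R_l^+(k)=\begin{bmatrix}1&0&0\\0&1&0\\0&0&e^{-ik\underline b}\end{bmatrix},$$ $$\Phi_l(x,k)=\begin{bmatrix}\{e^{ikx_j}\}_{j\in E_l}&0&0\\0&\{e^{ikx_j}\}_{j\in J_l}&\{e^{-ikx_j}\}_{j\in J_l}\end{bmatrix}\quad(\text{diagonal blocks}),$$ where $x_j$ is the coordinate on the edge $j$. For $k,\kappa\in\mathbb C\setminus\{0\}$ let $M_{n,m}(k,i\kappa)=\operatorname{diag}(M_n(k),M_m(i\kappa))$ for $M=X,Y,R^+$, let $\Phi_{n,m}(x,k,i\kappa)=\operatorname{diag}(\Phi_n(x,k),\Phi_m(x,i\kappa))$, $J_{n,m}=\operatorname{diag}(1,-1)$ and $I_{n,m}(k,i\kappa)=\operatorname{diag}(ik,-\kappa)$ on $\mathcal K_+\oplus\mathcal K_-$, and $W_{n,m}(k,i\kappa)=\operatorname{diag}\big(\tfrac{i}{2k},\tfrac{i}{2(i\kappa)}\big)$ on $\mathbb C^{\mathcal E_+\cup\mathcal I_+}\oplus\mathbb C^{\mathcal E_-\cup\mathcal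 I_-}$. Put $Z_{n,m}(k,i\kappa)=AX_{n,m}(k,i\kappa)+BY_{n,m}(k,i\kappa)$ and, where $Z_{n,m}(k,i\kappa)$ is invertible, $$\mathfrak X(k,i\kappa)=-Z_{n,m}(k,i\kappa)^{-1}\big(A+B\,I_{n,m}(-k,-i\kappa)\big),\qquad G_{n,m}(k,i\kappa)=\mathfrak X(k,i\kappa)\,R^+_{n,m}(k,i\kappa)^{-1}J_{n,m}.$$ Define the $(\mathcal E\cup\mathcal I)\times(\mathcal E\cup\mathcal I)$ matrices $$r^0(x,y,k,i\kappa)=\begin{bmatrix}\{\delta_{jj'}e^{ik|x_j-y_j|}\}&0\\0&-\{\delta_{jj'}e^{-\kappa|x_j-y_j|}\}\end{bmatrix}W_{n,m}(k,i\kappa),$$ $$r^1(x,y,k,i\kappa)=\Phi_{n,m}(x,k,i\kappa)\,G_{n,m}(k,i\kappa)\,\Phi_{n,m}(y,k,i\kappa)^T\,W_{n,m}(k,i\kappa).$$ Let $\mathcal Q=\{k:\operatorname{Re}k>0,\operatorname{Im}k>0\}$ and $\mathcal P=\{k:\operatorname{Re}k<0,\operatorname{Im}k>0\}$. A bounded operator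 $R$ on $\mathcal H$ is an *integral operator* with kernel $(r_{j,j'})$ if the functions $r_{j,j'}:I_j\times I_{j'}\to\mathbb C$ are measurable and, for all $\varphi\in\mathcal H$ and all $j,j'$, for almost every $x\in I_j$ the function $r_{j,j'}(x,\cdot)\varphi_{j'}$ is in $L^1(I_{j'})$, and $(R\varphi)_j(x)=\sum_{j'}\int_{I_{j'}}r_{j,j'}(x,y)\varphi_{j'}(y)\,dy$ for almost every $x\in I_j$. **Proposition 6.9.** Let $T(A,B)$ be self-adjoint. Every nonreal complex number is of the form $k^2$ with $k\in\mathcal Q\cup\mathcal P$. For $k\in\mathcal Q$ the matrix $Z_{n,m}(k,ik)$ is invertible, and for $k\in\mathcal P$ the matrix $Z_{n,m}(k,-ik)$ is invertible. For $k\in\mathcal Q\cup\mathcal P$ the resolvent $(T(A,B)-k^2)^{-1}$ exists as a bounded, everywhere defined operator, and it is the integral operator with kernel $$r(x,y,k)=\begin{cases}r^0(x,y,k,ik)+r^1(x,y,k,ik),&k\in\mathcal Q,\\ r^0(x,y,k,-ik)+r^1(x,y,k,-ik),&k\in\mathcal P.\end{cases}$$ -/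

import Mathlib

open MeasureTheory Set

noncomputable section

namespace IndefiniteGraph

/-! ### Finite metric graphs with positive and negative edges -/

/-- The edges: `Ep`, `Em` index the positive and negative external edges, `Ip`, `Im` the positive
and negative internal edges. -/
abbrev Edge (Ep Em Ip Im : Type*) := (Ep ⊕ Ip) ⊕ (Em ⊕ Im)

/-- The index set of the space `𝒦 = 𝒦₊ ⊕ 𝒦₋` of boundary values. An external edge contributes one
index; an internal edge contributes one index for its initial point and one for its end point. -/
abbrev BIdx (Ep Em Ip Im : Type*) := (Ep ⊕ (Ip ⊕ Ip)) ⊕ (Em ⊕ (Im ⊕ Im))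

/-- A metric graph with vertex set `V`, whose edges are divided into positive and negative ones. -/
structure SignedMetricGraph (V Ep Em Ip Im : Type*) where
  /-- initial and terminal vertex of an internal edge -/
  intBdry : Ip ⊕ Im → V × V
  /-- initial vertex of an external edge -/
  extBdry : Ep ⊕ Em → V
  /-- lengths of the positive internal edges -/
  lenP : Ip → ℝ
  /-- lengths of the negative internal edges -/
  lenM : Im → ℝ
  lenP_pos : ∀ i, 0 < lenP i
  lenM_pos : ∀ i, 0 < lenM i

/-! ### Absolutely continuous functions on an interval -/

/-- `f` is absolutely continuous on every compact interval contained in the interval `I`. -/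
def LocAC (f : ℝ → ℂ) (I : Set ℝ) : Prop :=
  ∀ a ∈ I, ∀ b ∈ I, AbsolutelyContinuousOnInterval f a b

/-- `ψ` belongs to `𝒟(I)`, with first derivative `ψ'` and second derivative `ψ''`: the functions
`ψ` and `ψ'` are absolutely continuous, and `ψ`, `ψ''` are square integrable on `I`. -/
structure IsDe (I : Set ℝ) (ψ ψ' ψ'' : ℝ → ℂ) : Prop where
  ac : LocAC ψ I
  ac' : LocAC ψ' I
  hasDeriv : ∀ x ∈ I, HasDerivWithinAt ψ (ψ' x) I x
  hasDeriv' : ∀ᵐ x ∂(volume.restrict I), HasDerivWithinAt ψ' (ψ'' x) I x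
  memLp : MemLp ψ 2 (volume.restrict I)
  memLp'' : MemLp ψ'' 2 (volume.restrict I)

/-! ### Resolvents and integral operators -/

/-- `R` is the resolvent `(T - z)⁻¹`, that is the bounded, everywhere defined two-sided inverse of
`T - z : Dom T → H`. -/
def IsResolventAt {H : Type*} [NormedAddCommGroup H] [NormedSpace ℂ H]
    (T : H →ₗ.[ℂ] H) (z : ℂ) (R : H →L[ℂ] H) : Prop :=
  (∀ f : H, ∃ h : R f ∈ T.domain, T ⟨R f, h⟩ - z • R f = f) ∧
    ∀ u : T.domain, R (T u - z • (u : H)) = u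

/-- The open first quadrant. -/
def quadrantQ : Set ℂ := {k | 0 < k.re ∧ 0 < k.im}

/-- The open second quadrant. -/
def quadrantP : Set ℂ := {k | k.re < 0 ∧ 0 < k.im}

/-! ### The matrices on one sign class of edges

`E` indexes external edges, `I` internal edges with lengths `b`. -/

section Blocks

variable {E I : Type*} [DecidableEq E] [DecidableEq I]

/-- The diagonal matrix `exp (i k b)`. -/
def expDiag (k : ℂ) (b : I → ℝ) : Matrix I I ℂ :=
  Matrix.diagonal fun i => Complex.exp (Complex.I * k * (b i : ℂ))

/-- Boundary values of the functions `exp (i k x)`, `exp (-i k x)`. -/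
def matX (E : Type*) [DecidableEq E] (k : ℂ) (b : I → ℝ) : Matrix (E ⊕ (I ⊕ I)) (E ⊕ (I ⊕ I)) ℂ :=
  Matrix.fromBlocks 1 0 0 (Matrix.fromBlocks 1 1 (expDiag k b) (expDiag (-k) b))

/-- Inward derivatives at the boundary of the functions `exp (i k x)`, `exp (-i k x)`. -/
def matY (E : Type*) [DecidableEq E] (k : ℂ) (b : I → ℝ) : Matrix (E ⊕ (I ⊕ I)) (E ⊕ (I ⊕ I)) ℂ :=
  (Complex.I * k) •
    Matrix.fromBlocks 1 0 0 (Matrix.fromBlocks 1 (-1) (-expDiag k b) (expDiag (-k) b))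

/-- The matrix `R⁺ = (X + (ik)⁻¹ Y) / 2 = diag (1, 1, exp (-i k b))`. -/
def matRp (E : Type*) [DecidableEq E] (k : ℂ) (b : I → ℝ) :
    Matrix (E ⊕ (I ⊕ I)) (E ⊕ (I ⊕ I)) ℂ :=
  Matrix.fromBlocks 1 0 0 (Matrix.fromBlocks 1 0 0 (expDiag (-k) b))

/-- The matrix `Φ(x, k)`. Its row `j` is evaluated at the point with coordinate `x` on the
edge `j`. -/
def matPhi (E I : Type*) [DecidableEq E] [DecidableEq I] (x : ℝ) (k : ℂ) :
    Matrix (E ⊕ I) (E ⊕ (I ⊕ I)) ℂ :=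
  Matrix.fromBlocks (expDiag k fun _ => x) 0 0
    (Matrix.fromCols (expDiag k fun _ => x) (expDiag (-k) fun _ => x))

end Blocks

namespace SignedMetricGraph

variable {V Ep Em Ip Im : Type*}

/-- The interval `I_j`: `[0, ∞)` for an external, `[0, a_j]` for an internal edge. -/
def interval (Γ : SignedMetricGraph V Ep Em Ip Im) : Edge Ep Em Ip Im → Set ℝ
  | Sum.inl (Sum.inl _) => Ici 0
  | Sum.inl (Sum.inr i) => Icc 0 (Γ.lenP i)
  | Sum.inr (Sum.inl _) => Ici 0
  | Sum.inr (Sum.inr i) => Icc 0 (Γ.lenM i)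

/-- The factor of the second derivative in `τ`: `-1` on positive, `+1` on negative edges. -/
def tauSign : Edge Ep Em Ip Im → ℂ
  | Sum.inl _ => -1
  | Sum.inr _ => 1

/-- The vector of boundary values of `ψ`. -/
def bdryVal (Γ : SignedMetricGraph V Ep Em Ip Im) (ψ : Edge Ep Em Ip Im → ℝ → ℂ) :
    BIdx Ep Em Ip Im → ℂ
  | Sum.inl (Sum.inl e) => ψ (Sum.inl (Sum.inl e)) 0
  | Sum.inl (Sum.inr (Sum.inl i)) => ψ (Sum.inl (Sum.inr i)) 0
  | Sum.inl (Sum.inr (Sum.inr i)) => ψ (Sum.inl (Sum.inr i)) (Γ.lenP i)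
  | Sum.inr (Sum.inl e) => ψ (Sum.inr (Sum.inl e)) 0
  | Sum.inr (Sum.inr (Sum.inl i)) => ψ (Sum.inr (Sum.inr i)) 0
  | Sum.inr (Sum.inr (Sum.inr i)) => ψ (Sum.inr (Sum.inr i)) (Γ.lenM i)

/-- The vector of inward boundary derivatives, in terms of the derivative `ψ'`. -/
def bdryDeriv (Γ : SignedMetricGraph V Ep Em Ip Im) (ψ' : Edge Ep Em Ip Im → ℝ → ℂ) :
    BIdx Ep Em Ip Im → ℂ
  | Sum.inl (Sum.inl e) => ψ' (Sum.inl (Sum.inl e)) 0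
  | Sum.inl (Sum.inr (Sum.inl i)) => ψ' (Sum.inl (Sum.inr i)) 0
  | Sum.inl (Sum.inr (Sum.inr i)) => -ψ' (Sum.inl (Sum.inr i)) (Γ.lenP i)
  | Sum.inr (Sum.inl e) => ψ' (Sum.inr (Sum.inl e)) 0
  | Sum.inr (Sum.inr (Sum.inl i)) => ψ' (Sum.inr (Sum.inr i)) 0
  | Sum.inr (Sum.inr (Sum.inr i)) => -ψ' (Sum.inr (Sum.inr i)) (Γ.lenM i)

/-- The Hilbert space `ℋ = ⨁ L²(I_j)`. -/
abbrev Hilb (Γ : SignedMetricGraph V Ep Em Ip Im) :=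
  PiLp 2 fun j : Edge Ep Em Ip Im => Lp ℂ 2 (volume.restrict (Γ.interval j))

theorem interval_props (Γ : SignedMetricGraph V Ep Em Ip Im) (j : Edge Ep Em Ip Im) :
    UniqueDiffOn ℝ (Γ.interval j) ∧ MeasurableSet (Γ.interval j) ∧
      Γ.interval j ⊆ closure (interior (Γ.interval j)) := by
  rcases j with (e | i) | (e | i)
  · exact ⟨uniqueDiffOn_Ici 0, measurableSet_Ici, by simp [interval]⟩
  · exact ⟨uniqueDiffOn_Icc (Γ.lenP_pos i), measurableSet_Icc, by
      simp [interval, interior_Icc, closure_Ioo (Γ.lenP_pos i).ne]⟩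
  · exact ⟨uniqueDiffOn_Ici 0, measurableSet_Ici, by simp [interval]⟩
  · exact ⟨uniqueDiffOn_Icc (Γ.lenM_pos i), measurableSet_Icc, by
      simp [interval, interior_Icc, closure_Ioo (Γ.lenM_pos i).ne]⟩

variable [Fintype Ep] [Fintype Em] [Fintype Ip] [Fintype Im]

/-- `g = T(A,B) f`: the function `f` has a representative `ψ ∈ 𝒟` that satisfies the boundary
condition, and `g = τ ψ`. -/
def TRel (Γ : SignedMetricGraph V Ep Em Ip Im)
    (A B : Matrix (BIdx Ep Em Ip Im) (BIdx Ep Em Ip Im) ℂ) (f g : Γ.Hilb) : Prop :=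
  ∃ ψ ψ' ψ'' : Edge Ep Em Ip Im → ℝ → ℂ,
    (∀ j, IsDe (Γ.interval j) (ψ j) (ψ' j) (ψ'' j)) ∧
    (∀ j, f j =ᵐ[volume.restrict (Γ.interval j)] ψ j) ∧
    (∀ j, g j =ᵐ[volume.restrict (Γ.interval j)] fun x => tauSign j * ψ'' j x) ∧
    A.mulVec (Γ.bdryVal ψ) + B.mulVec (Γ.bdryDeriv ψ') = 0

/-- The graph of `T(A,B)`. -/
def TGraph (Γ : SignedMetricGraph V Ep Em Ip Im)
    (A B : Matrix (BIdx Ep Em Ip Im) (BIdx Ep Em Ip Im) ℂ) : Submodule ℂ (Γ.Hilb × Γ.Hilb) where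
  carrier := {p | Γ.TRel A B p.1 p.2}
  zero_mem' := by
    refine ⟨fun _ _ => 0, fun _ _ => 0, fun _ _ => 0, fun j => ?_, fun j => ?_, fun j => ?_, ?_⟩
    · have h : LocAC (fun _ => (0 : ℂ)) (Γ.interval j) := fun a _ b _ =>
        LipschitzOnWith.absolutelyContinuousOnInterval (K := 0) (LipschitzWith.const 0).lipschitzOnWith
      exact ⟨h, h, fun x _ => hasDerivWithinAt_const _ _ _,
        Filter.Eventually.of_forall fun x => hasDerivWithinAt_const _ _ _,
        MemLp.zero', MemLp.zero'⟩
    · exact Lp.coeFn_zero ℂ 2 (volume.restrict (Γ.interval j))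
    · filter_upwards [Lp.coeFn_zero ℂ 2 (volume.restrict (Γ.interval j))] with x hx
      rw [mul_zero]
      exact hx
    · have h1 : Γ.bdryVal (fun _ _ => 0) = 0 := by
        funext b; rcases b with (_ | _ | _) | (_ | _ | _) <;> simp [bdryVal]
      have h2 : Γ.bdryDeriv (fun _ _ => 0) = 0 := by
        funext b; rcases b with (_ | _ | _) | (_ | _ | _) <;> simp [bdryDeriv]
      rw [h1, h2]; simp
  add_mem' := by
    rintro ⟨f, g⟩ ⟨f₁, g₁⟩ ⟨ψ, ψ', ψ'', h, hf, hg, hb⟩ ⟨φ, φ', φ'', k, kf, kg, kb⟩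
    refine ⟨fun j x => ψ j x + φ j x, fun j x => ψ' j x + φ' j x, fun j x => ψ'' j x + φ'' j x,
      fun j => ?_, fun j => ?_, fun j => ?_, ?_⟩
    · refine ⟨fun a ha b hb => ((h j).ac a ha b hb).add ((k j).ac a ha b hb),
        fun a ha b hb => ((h j).ac' a ha b hb).add ((k j).ac' a ha b hb),
        fun x hx => ((h j).hasDeriv x hx).add ((k j).hasDeriv x hx), ?_,
        (h j).memLp.add (k j).memLp, (h j).memLp''.add (k j).memLp''⟩
      filter_upwards [(h j).hasDeriv', (k j).hasDeriv'] with x h1 h2 using h1.add h2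
    · filter_upwards [Lp.coeFn_add (f j) (f₁ j), hf j, kf j] with x h1 h2 h3
      simpa [h2, h3] using h1
    · filter_upwards [Lp.coeFn_add (g j) (g₁ j), hg j, kg j] with x h1 h2 h3
      simp only [Prod.mk_add_mk, PiLp.add_apply]
      rw [h1, Pi.add_apply, h2, h3]; ring
    · have h1 : Γ.bdryVal (fun j x => ψ j x + φ j x) = Γ.bdryVal ψ + Γ.bdryVal φ := by
        funext b; rcases b with (_ | _ | _) | (_ | _ | _) <;> simp [bdryVal]
      have h2 : Γ.bdryDeriv (fun j x => ψ' j x + φ' j x) =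
          Γ.bdryDeriv ψ' + Γ.bdryDeriv φ' := by
        funext b
        rcases b with (_ | _ | _) | (_ | _ | _) <;> simp [bdryDeriv] <;> ring
      rw [h1, h2, Matrix.mulVec_add, Matrix.mulVec_add, add_add_add_comm, hb, kb, add_zero]
  smul_mem' := by
    rintro c ⟨f, g⟩ ⟨ψ, ψ', ψ'', h, hf, hg, hb⟩
    refine ⟨fun j x => c * ψ j x, fun j x => c * ψ' j x, fun j x => c * ψ'' j x,
      fun j => ?_, fun j => ?_, fun j => ?_, ?_⟩
    · refine ⟨fun a ha b hb => ((h j).ac a ha b hb).const_smul c,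
        fun a ha b hb => ((h j).ac' a ha b hb).const_smul c,
        fun x hx => ((h j).hasDeriv x hx).const_mul c, ?_,
        (h j).memLp.const_mul c, (h j).memLp''.const_mul c⟩
      filter_upwards [(h j).hasDeriv'] with x h1 using h1.const_mul c
    · filter_upwards [Lp.coeFn_smul c (f j), hf j] with x h1 h2
      simpa [h2] using h1
    · filter_upwards [Lp.coeFn_smul c (g j), hg j] with x h1 h2
      simp only [Prod.smul_mk, PiLp.smul_apply]
      rw [h1, Pi.smul_apply, h2, smul_eq_mul]; ring
    · have h1 : Γ.bdryVal (fun j x => c * ψ j x) = c • Γ.bdryVal ψ := by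
        funext b; rcases b with (_ | _ | _) | (_ | _ | _) <;> simp [bdryVal]
      have h2 : Γ.bdryDeriv (fun j x => c * ψ' j x) = c • Γ.bdryDeriv ψ' := by
        funext b; rcases b with (_ | _ | _) | (_ | _ | _) <;> simp [bdryDeriv]
      rw [h1, h2, Matrix.mulVec_smul, Matrix.mulVec_smul, ← smul_add, hb, smul_zero]

/-- `T(A,B) f` is determined by `f`. -/
theorem TGraph_single_valued (Γ : SignedMetricGraph V Ep Em Ip Im)
    (A B : Matrix (BIdx Ep Em Ip Im) (BIdx Ep Em Ip Im) ℂ) (p : Γ.Hilb × Γ.Hilb)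
    (hp : p ∈ Γ.TGraph A B) (h0 : p.1 = 0) : p.2 = 0 := by
  obtain ⟨ψ, ψ', ψ'', h, hf, hg, -⟩ := hp
  ext j : 1
  obtain ⟨hU, hM, hC⟩ := Γ.interval_props j
  have e0 : ψ j =ᵐ[volume.restrict (Γ.interval j)] fun _ => 0 := by
    have := Lp.coeFn_zero ℂ 2 (volume.restrict (Γ.interval j))
    have h2 := hf j
    rw [h0] at h2
    exact h2.symm.trans this
  have e1 : EqOn (ψ j) (fun _ => 0) (Γ.interval j) :=
    Measure.eqOn_of_ae_eq e0 (fun x hx => ((h j).hasDeriv x hx).continuousWithinAt)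
      continuousOn_const hC
  have e2 : EqOn (ψ' j) (fun _ => 0) (Γ.interval j) := fun x hx =>
    (hU x hx).eq_deriv _ ((h j).hasDeriv x hx)
      ((hasDerivWithinAt_const x _ (0 : ℂ)).congr e1 (e1 hx))
  refine Lp.ext ?_
  filter_upwards [hg j, (h j).hasDeriv', ae_restrict_mem hM,
    Lp.coeFn_zero ℂ 2 (volume.restrict (Γ.interval j))] with x h1 h2 hx h3
  have h4 : ψ'' j x = 0 := (hU x hx).eq_deriv _ h2
    ((hasDerivWithinAt_const x _ (0 : ℂ)).congr e2 (e2 hx))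
  rw [h1, h4, mul_zero]
  exact h3.symm

/-- The operator `T(A,B) = (τ, Dom T(A,B))`. -/
def T (Γ : SignedMetricGraph V Ep Em Ip Im)
    (A B : Matrix (BIdx Ep Em Ip Im) (BIdx Ep Em Ip Im) ℂ) : Γ.Hilb →ₗ.[ℂ] Γ.Hilb :=
  (Γ.TGraph A B).toLinearPMap

/-- The defining property of `T(A,B)`. -/
theorem mem_graph_T_iff (Γ : SignedMetricGraph V Ep Em Ip Im)
    (A B : Matrix (BIdx Ep Em Ip Im) (BIdx Ep Em Ip Im) ℂ) (p : Γ.Hilb × Γ.Hilb) :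
    p ∈ (Γ.T A B).graph ↔ Γ.TRel A B p.1 p.2 := by
  rw [T, Submodule.toLinearPMap_graph_eq _ (Γ.TGraph_single_valued A B)]
  rfl

/-- `R` is an integral operator with integral kernel `K`, where `K j j' x y` is the entry
`(j, j')` of the kernel at the point `x` of the edge `j` and the point `y` of the edge `j'`. -/
def IsIntegralOperator (Γ : SignedMetricGraph V Ep Em Ip Im) (R : Γ.Hilb →L[ℂ] Γ.Hilb)
    (K : Edge Ep Em Ip Im → Edge Ep Em Ip Im → ℝ → ℝ → ℂ) : Prop :=
  (∀ j j', Measurable fun p : Γ.interval j × Γ.interval j' => K j j' p.1 p.2) ∧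
  ∀ f : Γ.Hilb,
    (∀ j j', ∀ᵐ x ∂(volume.restrict (Γ.interval j)),
      IntegrableOn (fun y => K j j' x y * f j' y) (Γ.interval j')) ∧
    ∀ j, R f j =ᵐ[volume.restrict (Γ.interval j)]
      fun x => ∑ j', ∫ y in Γ.interval j', K j j' x y * f j' y

/-! ### The matrices of the whole graph

In the following definitions the second spectral argument `k'` stands for `i κ`. -/

variable [DecidableEq Ep] [DecidableEq Em] [DecidableEq Ip] [DecidableEq Im]

/-- The matrix `X(k, k')`. -/
def X (Γ : SignedMetricGraph V Ep Em Ip Im) (k k' : ℂ) :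
    Matrix (BIdx Ep Em Ip Im) (BIdx Ep Em Ip Im) ℂ :=
  Matrix.fromBlocks (matX Ep k Γ.lenP) 0 0 (matX Em k' Γ.lenM)

/-- The matrix `Y(k, k')`. -/
def Y (Γ : SignedMetricGraph V Ep Em Ip Im) (k k' : ℂ) :
    Matrix (BIdx Ep Em Ip Im) (BIdx Ep Em Ip Im) ℂ :=
  Matrix.fromBlocks (matY Ep k Γ.lenP) 0 0 (matY Em k' Γ.lenM)

/-- The matrix `Z(A, B, k, k') = A X(k, k') + B Y(k, k')`. -/
def Z (Γ : SignedMetricGraph V Ep Em Ip Im)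
    (A B : Matrix (BIdx Ep Em Ip Im) (BIdx Ep Em Ip Im) ℂ) (k k' : ℂ) :
    Matrix (BIdx Ep Em Ip Im) (BIdx Ep Em Ip Im) ℂ :=
  A * Γ.X k k' + B * Γ.Y k k'

/-- The matrix `diag (i k, i k')` on `𝒦₊ ⊕ 𝒦₋`. -/
def matI (k k' : ℂ) : Matrix (BIdx Ep Em Ip Im) (BIdx Ep Em Ip Im) ℂ :=
  Matrix.fromBlocks ((Complex.I * k) • 1) 0 0 ((Complex.I * k') • 1)

/-- The matrix `diag (1, -1)` on `𝒦₊ ⊕ 𝒦₋`. -/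
def matJ : Matrix (BIdx Ep Em Ip Im) (BIdx Ep Em Ip Im) ℂ :=
  Matrix.fromBlocks 1 0 0 (-1)

/-- The matrix `𝔛(k, k')`; it is meaningful if `Z(A, B, k, k')` is invertible. -/
def frakX (Γ : SignedMetricGraph V Ep Em Ip Im)
    (A B : Matrix (BIdx Ep Em Ip Im) (BIdx Ep Em Ip Im) ℂ) (k k' : ℂ) :
    Matrix (BIdx Ep Em Ip Im) (BIdx Ep Em Ip Im) ℂ :=
  -((Γ.Z A B k k')⁻¹ * (A + B * matI (-k) (-k')))

/-- The matrix `R⁺(k, k')`. -/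
def Rp (Γ : SignedMetricGraph V Ep Em Ip Im) (k k' : ℂ) :
    Matrix (BIdx Ep Em Ip Im) (BIdx Ep Em Ip Im) ℂ :=
  Matrix.fromBlocks (matRp Ep k Γ.lenP) 0 0 (matRp Em k' Γ.lenM)

/-- The matrix `G(k, k') = 𝔛(k, k') R⁺(k, k')⁻¹ J`. -/
def G (Γ : SignedMetricGraph V Ep Em Ip Im)
    (A B : Matrix (BIdx Ep Em Ip Im) (BIdx Ep Em Ip Im) ℂ) (k k' : ℂ) :
    Matrix (BIdx Ep Em Ip Im) (BIdx Ep Em Ip Im) ℂ :=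
  Γ.frakX A B k k' * (Γ.Rp k k')⁻¹ * matJ

/-- The matrix `Φ(x, k, k')`. -/
def Phi (x : ℝ) (k k' : ℂ) : Matrix (Edge Ep Em Ip Im) (BIdx Ep Em Ip Im) ℂ :=
  Matrix.fromBlocks (matPhi Ep Ip x k) 0 0 (matPhi Em Im x k')

/-- The matrix `W(k, k') = diag (i / (2 k), i / (2 k'))`. -/
def W (k k' : ℂ) : Matrix (Edge Ep Em Ip Im) (Edge Ep Em Ip Im) ℂ :=
  Matrix.fromBlocks ((Complex.I / (2 * k)) • 1) 0 0 ((Complex.I / (2 * k')) • 1)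

/-- The free Green's function `r⁰(x, y, k, k')`. -/
def r0 (x y : ℝ) (k k' : ℂ) : Matrix (Edge Ep Em Ip Im) (Edge Ep Em Ip Im) ℂ :=
  Matrix.fromBlocks (Complex.exp (Complex.I * k * (|x - y| : ℝ)) • 1) 0 0
    (-(Complex.exp (Complex.I * k' * (|x - y| : ℝ)) • 1)) * W k k'

/-- The correction term `r¹(x, y, k, k')`. -/
def r1 (Γ : SignedMetricGraph V Ep Em Ip Im)
    (A B : Matrix (BIdx Ep Em Ip Im) (BIdx Ep Em Ip Im) ℂ) (x y : ℝ) (k k' : ℂ) :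
    Matrix (Edge Ep Em Ip Im) (Edge Ep Em Ip Im) ℂ :=
  (Phi x k k' : Matrix (Edge Ep Em Ip Im) (BIdx Ep Em Ip Im) ℂ) * Γ.G A B k k' *
    (Phi y k k' : Matrix (Edge Ep Em Ip Im) (BIdx Ep Em Ip Im) ℂ).transpose * W k k'

/-- The kernel `r⁰ + r¹`: its entry `(j, j')` at the point `x` of the edge `j` and the point `y` of
the edge `j'`. -/
def kernel (Γ : SignedMetricGraph V Ep Em Ip Im)
    (A B : Matrix (BIdx Ep Em Ip Im) (BIdx Ep Em Ip Im) ℂ) (k k' : ℂ)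
    (j j' : Edge Ep Em Ip Im) (x y : ℝ) : ℂ :=
  (r0 x y k k' : Matrix (Edge Ep Em Ip Im) (Edge Ep Em Ip Im) ℂ) j j' + Γ.r1 A B x y k k' j j'

end SignedMetricGraph

end IndefiniteGraph

end

/-! Write `k'` for `ik` if `k ∈ 𝒬` and for `-ik` if `k ∈ 𝒫`. In both cases `k` and `k'` lie in the
upper half plane and `k'² = -k²`. Hence `exp(±ikx)` on positive edges and `exp(±ik'x)` on negative
ones solve `τψ = k²ψ`, and the plus sign gives the solution that is square integrable on a half
line.

Invertibility of `Z`: a superposition `Φ(x)v` of these exponentials has boundary values `Xv` and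
inward derivatives `Yv`, so it satisfies the boundary condition iff `Zv = 0`. In that case it is an
eigenfunction or zero; a self-adjoint operator has no nonreal eigenvalue `k²`, so `Φv = 0`, whence
`Xv = Yv = 0` and `v = 0` (`isUnit_det_Z`).

Resolvent: on each edge, integration against `r⁰` solves `(τ - k²)ψ = f` by variation of constants
(`isDe_freePart`), and Young's inequality keeps the result in `L²`. Since `f` lives on the edge,
this solution is a pure outgoing exponential at each end point. Its inward derivatives are therefore
`diag(-ik, -ik')` times its values (`bdryDeriv_freePart`), and its values are `(R⁺)⁻¹J` applied to
the integrals of `ΦᵀWf` (`Rp_mulVec_bdryVal_freePart`). Adding `Φv` repairs the boundary condition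
iff `Zv = -(A + B diag(-ik, -ik'))` applied to these values, that is, for `v = G ∫ΦᵀWf`. This is the
term `r¹` (`exists_solution`, `sum_integral_kernel_mul`).

So `T - k²` is onto, and `|Im z| ‖u‖ ≤ ‖(T - z)u‖` makes its inverse bounded
(`exists_isResolventAt`). -/

/-! ### Absolutely continuous functions -/

/-- A function that varies less than an absolutely continuous one is absolutely continuous. -/
theorem AbsolutelyContinuousOnInterval.of_dist_le {X Y : Type*} [PseudoMetricSpace X]
    [PseudoMetricSpace Y] {f : ℝ → X} {g : ℝ → Y} {a b : ℝ}
    (hg : AbsolutelyContinuousOnInterval g a b) (h : ∀ x y, dist (f x) (f y) ≤ dist (g x) (g y)) :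
    AbsolutelyContinuousOnInterval f a b := by
  rw [absolutelyContinuousOnInterval_iff] at hg ⊢
  intro ε hε
  obtain ⟨δ, hδ, H⟩ := hg ε hε
  exact ⟨δ, hδ, fun E hE hs =>
    (Finset.sum_le_sum fun i _ => h _ _).trans_lt (H E hE hs)⟩

theorem MeasureTheory.LocallyIntegrable.intervalIntegrable' {f : ℝ → ℂ} (hf : LocallyIntegrable f)
    (a b : ℝ) : IntervalIntegrable f volume a b :=
  (hf.integrableOn_isCompact isCompact_uIcc).intervalIntegrable

/-- Increments of the integral of `f` are dominated by those of the integral of `‖f‖`, which reduces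
the complex case to the real one. -/
theorem MeasureTheory.LocallyIntegrable.absolutelyContinuousOnInterval_integral {f : ℝ → ℂ}
    (hf : LocallyIntegrable f) (a b c : ℝ) :
    AbsolutelyContinuousOnInterval (fun x => ∫ t in c..x, f t) a b := by
  have hn : ∀ a b : ℝ, IntervalIntegrable (fun x => ‖f x‖) volume a b := fun a b =>
    (hf.intervalIntegrable' a b).norm
  refine ((hn a b).absolutelyContinuousOnInterval_intervalIntegral left_mem_uIcc).of_dist_le
    fun x y => ?_
  rw [dist_eq_norm, dist_eq_norm, intervalIntegral.integral_interval_sub_left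
    (hf.intervalIntegrable' _ _) (hf.intervalIntegrable' _ _),
    intervalIntegral.integral_interval_sub_left (hn _ _) (hn _ _)]
  exact intervalIntegral.norm_integral_le_abs_integral_norm

theorem absolutelyContinuousOnInterval_cexp (c : ℂ) (a b : ℝ) :
    AbsolutelyContinuousOnInterval (fun x : ℝ => Complex.exp (c * x)) a b := by
  have : ContDiff ℝ 1 (fun x : ℝ => Complex.exp (c * x)) :=
    (contDiff_const.mul Complex.ofRealCLM.contDiff).cexp
  exact this.contDiffOn.absolutelyContinuousOnInterval

/-- An absolutely continuous function whose derivative coincides almost everywhere with a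
continuous function is differentiable everywhere. -/
theorem hasDerivAt_of_ae_of_continuous {f g : ℝ → ℂ}
    (hf : ∀ a b, AbsolutelyContinuousOnInterval f a b) (hg : Continuous g)
    (h : ∀ᵐ x, HasDerivAt f (g x) x) (x : ℝ) : HasDerivAt f (g x) x := by
  have hG : ∀ x, HasDerivAt (fun x => ∫ t in (0 : ℝ)..x, g t) (g x) x := fun x =>
    (hg.integral_hasStrictDerivAt 0 x).hasDerivAt
  -- The difference of `f` and a primitive of `g` is absolutely continuous with derivative zero
  -- almost everywhere, hence constant near `x`; the radius 1 is arbitrary.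
  have hac : AbsolutelyContinuousOnInterval (fun y => f y - ∫ t in (0 : ℝ)..y, g t)
      (x - 1) (x + 1) :=
    (hf _ _).fun_sub (hg.locallyIntegrable.absolutelyContinuousOnInterval_integral _ _ _)
  obtain ⟨C, hC⟩ := hac.const_of_ae_hasDerivAt_zero (by
    filter_upwards [h] with y hy _
    simpa using! hy.sub (hG y))
  have hev : f =ᶠ[nhds x] fun y => C + ∫ t in (0 : ℝ)..y, g t := by
    filter_upwards [Icc_mem_nhds (show x - 1 < x by linarith) (show x < x + 1 by linarith)]
      with y hy
    rw [← hC y (by rwa [uIcc_of_le (by linarith)])]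
    ring
  exact ((hG x).const_add C).congr_of_eventuallyEq hev

/-! ### Exponential kernels on `L²` -/

/-- Young's inequality `‖k * g‖₂ ≤ ‖k‖₁ ‖g‖₂`, squared. Cauchy–Schwarz for the splitting `k g =
k^(1/2) · (k^(1/2) g)` gives a pointwise bound, which Tonelli and translation invariance integrate.
-/
theorem lintegral_sq_convolution_le {k g : ℝ → ENNReal} (hk : Measurable k)
    (hg : AEMeasurable g) :
    ∫⁻ x, (∫⁻ y, k (x - y) * g y) ^ (2 : ℝ) ≤
      (∫⁻ x, k x) * (∫⁻ x, k x) * ∫⁻ y, g y ^ (2 : ℝ) := by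
  have hkm : ∀ x : ℝ, Measurable fun y => k (x - y) := fun x =>
    hk.comp (measurable_const.sub measurable_id)
  have key : ∀ x, (∫⁻ y, k (x - y) * g y) ^ (2 : ℝ) ≤
      (∫⁻ x, k x) * ∫⁻ y, k (x - y) * g y ^ (2 : ℝ) := by
    intro x
    have hs : ∀ y, k (x - y) ^ (1 / 2 : ℝ) * (k (x - y) ^ (1 / 2 : ℝ) * g y) =
        k (x - y) * g y := by
      intro y
      rw [← mul_assoc, ← ENNReal.rpow_add_of_nonneg _ _ (by norm_num) (by norm_num)]
      norm_num
    have h1 := ENNReal.lintegral_mul_le_Lp_mul_Lq volume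
      (Real.HolderConjugate.two_two)
      ((hkm x).pow_const (1 / 2 : ℝ)).aemeasurable
      (((hkm x).pow_const (1 / 2 : ℝ)).aemeasurable.mul hg)
    have h2 := ENNReal.rpow_le_rpow h1 (show (0 : ℝ) ≤ 2 by norm_num)
    simp only [Pi.mul_apply, hs] at h2
    refine h2.trans_eq ?_
    rw [ENNReal.mul_rpow_of_nonneg _ _ (by norm_num), ← ENNReal.rpow_mul, ← ENNReal.rpow_mul]
    norm_num only [ENNReal.rpow_one]
    congr 1
    · rw [← lintegral_sub_left_eq_self k x]
      refine lintegral_congr fun y => ?_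
      rw [← ENNReal.rpow_mul]; norm_num
    · refine lintegral_congr fun y => ?_
      rw [ENNReal.mul_rpow_of_nonneg _ _ (by norm_num), ← ENNReal.rpow_mul]
      norm_num
  have hm : AEMeasurable (Function.uncurry fun x y : ℝ => k (x - y) * g y ^ (2 : ℝ))
      (volume.prod volume) :=
    ((hk.comp (measurable_fst.sub measurable_snd)).aemeasurable).mul
      ((hg.comp_quasiMeasurePreserving Measure.quasiMeasurePreserving_snd).pow_const _)
  calc ∫⁻ x, (∫⁻ y, k (x - y) * g y) ^ (2 : ℝ)
      ≤ ∫⁻ x, (∫⁻ x, k x) * ∫⁻ y, k (x - y) * g y ^ (2 : ℝ) := lintegral_mono key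
    _ = (∫⁻ x, k x) * ∫⁻ x, ∫⁻ y, k (x - y) * g y ^ (2 : ℝ) :=
        lintegral_const_mul'' _ hm.lintegral_prod_right'
    _ = (∫⁻ x, k x) * ∫⁻ y, ∫⁻ x, k (x - y) * g y ^ (2 : ℝ) := by
        rw [lintegral_lintegral_swap hm]
    _ = (∫⁻ x, k x) * ∫⁻ y, (∫⁻ x, k x) * g y ^ (2 : ℝ) := by
        congr 1
        refine lintegral_congr fun y => ?_
        have hky : Measurable fun x => k (x - y) := hk.comp (measurable_id.sub measurable_const)
        rw [lintegral_mul_const _ hky, lintegral_sub_right_eq_self k y]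
    _ = _ := by rw [lintegral_const_mul'' _ (hg.pow_const _), mul_assoc]

theorem integrable_cexp_mul_abs {c : ℂ} (hc : c.re < 0) :
    Integrable fun x : ℝ => Complex.exp (c * (|x| : ℝ)) := by
  have h := integrableOn_exp_mul_complex_Ioi hc 0
  have h1 : IntegrableOn (fun x : ℝ => Complex.exp (c * (|x| : ℝ))) (Ioi 0) :=
    h.congr_fun (fun x hx => by simp [abs_of_pos (mem_Ioi.1 hx)]) measurableSet_Ioi
  have h2 : IntegrableOn (fun x : ℝ => Complex.exp (c * (|x| : ℝ))) (Iic 0) := by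
    rw [integrableOn_Iic_iff_integrableOn_Iio]
    simpa using h1.comp_neg
  rw [← integrableOn_univ, ← Iic_union_Ioi (a := (0 : ℝ))]
  exact h2.union h1

theorem memLp_two_cexp_Ici {c : ℂ} (hc : c.re < 0) :
    MemLp (fun x : ℝ => Complex.exp (c * x)) 2 (volume.restrict (Ici 0)) := by
  rw [memLp_two_iff_integrable_sq_norm (by fun_prop)]
  -- The squared norm of `exp (c x)` is the norm of `exp (2 c x)`.
  have h := (integrableOn_exp_mul_complex_Ioi (a := 2 * c) (by simp; linarith) 0).norm
  change IntegrableOn _ _ _ at h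
  rw [← integrableOn_Ici_iff_integrableOn_Ioi] at h
  refine h.congr (Filter.Eventually.of_forall fun x => ?_)
  simp only [← norm_pow, ← Complex.exp_nat_mul]
  congr 2
  push_cast; ring

theorem memLp_two_cexp_mul_abs {c : ℂ} (hc : c.re < 0) (a : ℝ) :
    MemLp (fun x : ℝ => Complex.exp (c * (|a - x| : ℝ))) 2 volume := by
  rw [memLp_two_iff_integrable_sq_norm (by fun_prop)]
  have h := ((integrable_cexp_mul_abs (c := 2 * c) (by simp; linarith)).comp_sub_left a).norm
  refine h.congr (Filter.Eventually.of_forall fun x => ?_)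
  simp only [← norm_pow, ← Complex.exp_nat_mul]
  congr 2
  push_cast; ring

/-- Young's inequality for the integrable kernel `exp (c|x|)`; this puts the free solution into
`L²`, also on half lines. -/
theorem memLp_two_of_eq_integral_cexp {c : ℂ} (hc : c.re < 0) {f u : ℝ → ℂ} {S : Set ℝ}
    (hS : MeasurableSet S) (hf : MemLp f 2 volume) (hu : Continuous u)
    (h : ∀ x ∈ S, u x = ∫ t, Complex.exp (c * (|x - t| : ℝ)) * f t) :
    MemLp u 2 (volume.restrict S) := by
  refine ⟨hu.aestronglyMeasurable, ?_⟩
  rw [eLpNorm_lt_top_iff_lintegral_rpow_enorm_lt_top (by norm_num) (by norm_num)]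
  simp only [ENNReal.toReal_ofNat]
  have hk : Measurable fun x : ℝ => ‖Complex.exp (c * (|x| : ℝ))‖ₑ := by fun_prop
  have h1 : ∫⁻ x in S, ‖u x‖ₑ ^ (2 : ℝ) ≤
      ∫⁻ x, (∫⁻ t, ‖Complex.exp (c * (|x - t| : ℝ))‖ₑ * ‖f t‖ₑ) ^ (2 : ℝ) := by
    refine (setLIntegral_mono' hS fun x hx => ?_).trans (setLIntegral_le_lintegral _ _)
    refine ENNReal.rpow_le_rpow ?_ (by norm_num)
    rw [h x hx]
    refine (enorm_integral_le_lintegral_enorm _).trans_eq ?_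
    simp only [enorm_mul]
  refine (h1.trans (lintegral_sq_convolution_le hk hf.1.enorm)).trans_lt ?_
  have h2 := (integrable_cexp_mul_abs hc).2
  have h3 := (eLpNorm_lt_top_iff_lintegral_rpow_enorm_lt_top (by norm_num) (by norm_num)).1 hf.2
  simp only [ENNReal.toReal_ofNat] at h3
  exact ENNReal.mul_lt_top (ENNReal.mul_lt_top h2 h2) h3

namespace IndefiniteGraph

/-! ### The class `𝒟(I)` -/

theorem IsDe.add {I : Set ℝ} {f f' f'' g g' g'' : ℝ → ℂ} (hf : IsDe I f f' f'')
    (hg : IsDe I g g' g'') :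
    IsDe I (fun x => f x + g x) (fun x => f' x + g' x) (fun x => f'' x + g'' x) := by
  refine ⟨fun a ha b hb => (hf.ac a ha b hb).add (hg.ac a ha b hb),
    fun a ha b hb => (hf.ac' a ha b hb).add (hg.ac' a ha b hb),
    fun x hx => (hf.hasDeriv x hx).add (hg.hasDeriv x hx), ?_,
    hf.memLp.add hg.memLp, hf.memLp''.add hg.memLp''⟩
  filter_upwards [hf.hasDeriv', hg.hasDeriv'] with x h1 h2 using h1.add h2

theorem IsDe.const_mul {I : Set ℝ} {f f' f'' : ℝ → ℂ} (c : ℂ) (hf : IsDe I f f' f'') :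
    IsDe I (fun x => c * f x) (fun x => c * f' x) (fun x => c * f'' x) := by
  refine ⟨fun a ha b hb => (hf.ac a ha b hb).const_smul c,
    fun a ha b hb => (hf.ac' a ha b hb).const_smul c,
    fun x hx => (hf.hasDeriv x hx).const_mul c, ?_,
    hf.memLp.const_mul c, hf.memLp''.const_mul c⟩
  filter_upwards [hf.hasDeriv'] with x h1 using h1.const_mul c

theorem IsDe.zero (I : Set ℝ) : IsDe I (fun _ => 0) (fun _ => 0) (fun _ => 0) := by
  have h : LocAC (fun _ => (0 : ℂ)) I := fun a _ b _ =>
    LipschitzOnWith.absolutelyContinuousOnInterval (K := 0) (LipschitzWith.const 0).lipschitzOnWith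
  exact ⟨h, h, fun x _ => hasDerivWithinAt_const _ _ _,
    Filter.Eventually.of_forall fun x => hasDerivWithinAt_const _ _ _, MemLp.zero', MemLp.zero'⟩

theorem IsDe.sum {ι : Type*} (s : Finset ι) {I : Set ℝ} {f f' f'' : ι → ℝ → ℂ}
    (h : ∀ i ∈ s, IsDe I (f i) (f' i) (f'' i)) :
    IsDe I (fun x => ∑ i ∈ s, f i x) (fun x => ∑ i ∈ s, f' i x) (fun x => ∑ i ∈ s, f'' i x) := by
  classical
  induction s using Finset.induction_on with
  | empty => simpa using IsDe.zero I
  | insert a s ha ih =>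
    simp only [Finset.sum_insert ha]
    exact (h a (Finset.mem_insert_self _ _)).add
      (ih fun i hi => h i (Finset.mem_insert_of_mem hi))

theorem hasDerivAt_cexp_mul (c : ℂ) (x : ℝ) :
    HasDerivAt (fun x : ℝ => Complex.exp (c * x)) (c * Complex.exp (c * x)) x := by
  have := ((hasDerivAt_id x).ofReal_comp.const_mul c).cexp
  simpa [mul_comm] using this

theorem isDe_cexp {I : Set ℝ} {c : ℂ}
    (h : MemLp (fun x : ℝ => Complex.exp (c * x)) 2 (volume.restrict I)) :
    IsDe I (fun x => Complex.exp (c * x)) (fun x => c * Complex.exp (c * x))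
      (fun x => c * (c * Complex.exp (c * x))) :=
  ⟨fun a _ b _ => absolutelyContinuousOnInterval_cexp c a b,
    fun a _ b _ => (absolutelyContinuousOnInterval_cexp c a b).const_smul c,
    fun x _ => (hasDerivAt_cexp_mul c x).hasDerivWithinAt,
    Filter.Eventually.of_forall fun x =>
      ((hasDerivAt_cexp_mul c x).const_mul c).hasDerivWithinAt,
    h, (h.const_mul c).const_mul c⟩

/-! ### The free solution of `u'' - c² u = 2 c f` on a half line -/

/-- The value at `x` of the solution, in variation of constants form. -/
noncomputable def freeSol (c : ℂ) (f : ℝ → ℂ) (x : ℝ) : ℂ :=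
  Complex.exp (c * x) * (∫ t in (0 : ℝ)..x, Complex.exp (-c * t) * f t) +
    Complex.exp (-c * x) * ((∫ t : ℝ, Complex.exp (c * t) * f t) -
      ∫ t in (0 : ℝ)..x, Complex.exp (c * t) * f t)

/-- The derivative of `freeSol c f`. -/
noncomputable def freeSolDeriv (c : ℂ) (f : ℝ → ℂ) (x : ℝ) : ℂ :=
  c * (Complex.exp (c * x) * (∫ t in (0 : ℝ)..x, Complex.exp (-c * t) * f t) -
    Complex.exp (-c * x) * ((∫ t : ℝ, Complex.exp (c * t) * f t) -
      ∫ t in (0 : ℝ)..x, Complex.exp (c * t) * f t))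

section FreeSol

variable {c : ℂ} {f : ℝ → ℂ}

theorem locallyIntegrable_cexp_mul (c : ℂ) (hf : MemLp f 2 volume) :
    LocallyIntegrable fun t : ℝ => Complex.exp (c * t) * f t :=
  (hf.locallyIntegrable (by norm_num)).continuous_mul (by fun_prop)

theorem absolutelyContinuousOnInterval_cexp_mul_integral (c d e : ℂ) (hf : MemLp f 2 volume)
    (a b : ℝ) : AbsolutelyContinuousOnInterval (fun x => Complex.exp (c * x) *
      (e - ∫ t in (0 : ℝ)..x, Complex.exp (d * t) * f t)) a b :=
  (absolutelyContinuousOnInterval_cexp c a b).fun_smul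
    ((LipschitzOnWith.absolutelyContinuousOnInterval (K := 0)
      (LipschitzWith.const e).lipschitzOnWith).fun_sub
      ((locallyIntegrable_cexp_mul d hf).absolutelyContinuousOnInterval_integral a b 0))

theorem absolutelyContinuousOnInterval_cexp_mul_integral' (c d : ℂ) (hf : MemLp f 2 volume)
    (a b : ℝ) : AbsolutelyContinuousOnInterval (fun x => Complex.exp (c * x) *
      (∫ t in (0 : ℝ)..x, Complex.exp (d * t) * f t)) a b :=
  (absolutelyContinuousOnInterval_cexp c a b).fun_smul
    ((locallyIntegrable_cexp_mul d hf).absolutelyContinuousOnInterval_integral a b 0)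

theorem absolutelyContinuousOnInterval_freeSol (c : ℂ) (hf : MemLp f 2 volume) (a b : ℝ) :
    AbsolutelyContinuousOnInterval (freeSol c f) a b :=
  (absolutelyContinuousOnInterval_cexp_mul_integral' _ _ hf a b).fun_add
    (absolutelyContinuousOnInterval_cexp_mul_integral _ _ _ hf a b)

theorem absolutelyContinuousOnInterval_freeSolDeriv (c : ℂ) (hf : MemLp f 2 volume) (a b : ℝ) :
    AbsolutelyContinuousOnInterval (freeSolDeriv c f) a b :=
  ((absolutelyContinuousOnInterval_cexp_mul_integral' _ _ hf a b).fun_sub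
    (absolutelyContinuousOnInterval_cexp_mul_integral _ _ _ hf a b)).const_smul c

theorem continuous_of_absolutelyContinuousOnInterval {u : ℝ → ℂ}
    (h : ∀ a b, AbsolutelyContinuousOnInterval u a b) : Continuous u :=
  continuous_iff_continuousAt.2 fun x => (h (x - 1) (x + 1)).continuousOn.continuousAt
    (by rw [uIcc_of_le (by linarith)]; exact Icc_mem_nhds (by linarith) (by linarith))

/-- The terms from differentiating the two integrals cancel in the first derivative and add up to `2
c f` in the second. Lebesgue differentiation gives this only almost everywhere. -/
theorem ae_hasDerivAt_freeSol (c : ℂ) (hf : MemLp f 2 volume) :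
    ∀ᵐ x, HasDerivAt (freeSol c f) (freeSolDeriv c f x) x ∧
      HasDerivAt (freeSolDeriv c f) (c ^ 2 * freeSol c f x + 2 * c * f x) x := by
  filter_upwards [LocallyIntegrable.ae_hasDerivAt_integral (locallyIntegrable_cexp_mul (-c) hf),
    LocallyIntegrable.ae_hasDerivAt_integral (locallyIntegrable_cexp_mul c hf)] with x h1 h2
  have e1 := (hasDerivAt_cexp_mul c x).mul (h1 0)
  have e2 := (hasDerivAt_cexp_mul (-c) x).mul
    ((h2 0).const_sub (∫ t : ℝ, Complex.exp (c * t) * f t))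
  have hi : Complex.exp (c * x) * Complex.exp (-c * x) = 1 := by
    rw [← Complex.exp_add]; simp
  refine ⟨(e1.add e2).congr_deriv ?_, ((e1.sub e2).const_mul c).congr_deriv ?_⟩
  · rw [freeSolDeriv]
    ring
  · rw [freeSol]
    linear_combination 2 * c * f x * hi

/-- `IsDe` asks for the first derivative at every point; continuity of `freeSolDeriv` removes the
null set. -/
theorem hasDerivAt_freeSol (c : ℂ) (hf : MemLp f 2 volume) (x : ℝ) :
    HasDerivAt (freeSol c f) (freeSolDeriv c f x) x :=
  hasDerivAt_of_ae_of_continuous (absolutelyContinuousOnInterval_freeSol c hf)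
    (continuous_of_absolutelyContinuousOnInterval
      (absolutelyContinuousOnInterval_freeSolDeriv c hf))
    ((ae_hasDerivAt_freeSol c hf).mono fun _ h => h.1) x

theorem integrable_cexp_mul_of_Ici (hc : c.re < 0) (hf : MemLp f 2 volume)
    (h0 : ∀ t < 0, f t = 0) : Integrable fun t : ℝ => Complex.exp (c * t) * f t := by
  have h : IntegrableOn (fun t : ℝ => Complex.exp (c * t) * f t) (Ici 0) :=
    (memLp_two_cexp_Ici hc).integrable_mul (hf.restrict _)
  exact h.integrable_of_forall_notMem_eq_zero fun t ht => by
    rw [h0 t (not_le.1 ht), mul_zero]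

/-- Only the compact interval `[0, x]` contributes, so no sign of `d.re` is needed; the growing
exponential `d = -c` is one of the cases used. -/
theorem integral_Iic_cexp_mul (d : ℂ) (hf : MemLp f 2 volume) (h0 : ∀ t < 0, f t = 0) (x : ℝ) :
    IntegrableOn (fun t : ℝ => Complex.exp (d * t) * f t) (Iic x) ∧
    ∫ t in Iic x, Complex.exp (d * t) * f t = ∫ t in (0 : ℝ)..x, Complex.exp (d * t) * f t := by
  have hz : EqOn (fun t : ℝ => Complex.exp (d * t) * f t) (fun _ => 0) (Iio 0) := fun t ht => by
    simp [h0 t ht]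
  have hi : ∀ x, IntegrableOn (fun t : ℝ => Complex.exp (d * t) * f t) (Iic x) := by
    intro x
    have h1 : IntegrableOn (fun t : ℝ => Complex.exp (d * t) * f t) (Iio 0) :=
      (integrableOn_zero (μ := volume)).congr_fun hz.symm measurableSet_Iio
    have h2 := (locallyIntegrable_cexp_mul d hf).integrableOn_isCompact
      (isCompact_Icc (a := 0) (b := x))
    exact (h1.union h2).mono_set fun t ht => by
      rcases lt_or_ge t 0 with h | h
      exacts [Or.inl h, Or.inr ⟨h, ht⟩]
  refine ⟨hi x, ?_⟩
  rw [← intervalIntegral.integral_Iic_sub_Iic (hi 0) (hi x), integral_Iic_eq_integral_Iio (x := 0),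
    setIntegral_congr_fun measurableSet_Iio hz]
  simp

/-- Splitting the line at `x` factorises the kernel: it is `exp (c x) exp (-c t)` for `t ≤ x` and
`exp (-c x) exp (c t)` for `t > x`. -/
theorem freeSol_eq_integral (hc : c.re < 0) (hf : MemLp f 2 volume)
    (h0 : ∀ t < 0, f t = 0) (x : ℝ) :
    freeSol c f x = ∫ t : ℝ, Complex.exp (c * (|x - t| : ℝ)) * f t := by
  have hI := integrable_cexp_mul_of_Ici hc hf h0
  have hA : Integrable fun t : ℝ => Complex.exp (c * (|x - t| : ℝ)) * f t :=
    (memLp_two_cexp_mul_abs hc x).integrable_mul hf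
  have e1 : ∫ t in Iic x, Complex.exp (c * (|x - t| : ℝ)) * f t =
      ∫ t in Iic x, Complex.exp (c * x) * (Complex.exp (-c * t) * f t) := by
    refine setIntegral_congr_fun measurableSet_Iic fun t ht => ?_
    have ht' : t ≤ x := ht
    simp only [abs_of_nonneg (sub_nonneg.2 ht'), ← mul_assoc, ← Complex.exp_add]
    congr 2; push_cast; ring
  have e2 : ∫ t in Ioi x, Complex.exp (c * (|x - t| : ℝ)) * f t =
      ∫ t in Ioi x, Complex.exp (-c * x) * (Complex.exp (c * t) * f t) := by
    refine setIntegral_congr_fun measurableSet_Ioi fun t ht => ?_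
    have ht' : x < t := ht
    simp only [abs_of_neg (sub_neg.2 ht'), ← mul_assoc, ← Complex.exp_add]
    congr 2; push_cast; ring
  rw [← intervalIntegral.integral_Iic_add_Ioi (b := x) hA.integrableOn hA.integrableOn, e1, e2,
    integral_const_mul, integral_const_mul, freeSol, (integral_Iic_cexp_mul (-c) hf h0 x).2,
    ← (integral_Iic_cexp_mul c hf h0 x).2,
    ← intervalIntegral.integral_Iic_add_Ioi (b := x) hI.integrableOn hI.integrableOn]
  ring

theorem isDe_freeSol (hc : c.re < 0) (hf : MemLp f 2 volume) (h0 : ∀ t < 0, f t = 0)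
    {S : Set ℝ} (hS : MeasurableSet S) :
    IsDe S (freeSol c f) (freeSolDeriv c f) (fun x => c ^ 2 * freeSol c f x + 2 * c * f x) := by
  have hL : MemLp (freeSol c f) 2 (volume.restrict S) :=
    memLp_two_of_eq_integral_cexp hc hS hf
      (continuous_of_absolutelyContinuousOnInterval (absolutelyContinuousOnInterval_freeSol c hf))
      fun x _ => freeSol_eq_integral hc hf h0 x
  exact ⟨fun a _ b _ => absolutelyContinuousOnInterval_freeSol c hf a b,
    fun a _ b _ => absolutelyContinuousOnInterval_freeSolDeriv c hf a b,
    fun x _ => (hasDerivAt_freeSol c hf x).hasDerivWithinAt,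
    ae_restrict_of_ae ((ae_hasDerivAt_freeSol c hf).mono fun _ h => h.2.hasDerivWithinAt),
    hL, (hL.const_mul _).add ((hf.restrict S).const_mul _)⟩

theorem freeSol_zero (c : ℂ) (f : ℝ → ℂ) :
    freeSol c f 0 = ∫ t : ℝ, Complex.exp (c * t) * f t := by
  simp [freeSol]

/-- Together with `freeSol_right` this shows that at either end point the inward derivative is `-c`
times the value. -/
theorem freeSolDeriv_zero (c : ℂ) (f : ℝ → ℂ) : freeSolDeriv c f 0 = -c * freeSol c f 0 := by
  simp [freeSol, freeSolDeriv]

/-- The values at the end point of an interval that contains the support of `f`. -/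
theorem freeSol_right (c : ℂ) (hf : MemLp f 2 volume) (h0 : ∀ t < 0, f t = 0) {a : ℝ}
    (ha : ∀ t, a < t → f t = 0) :
    freeSol c f a = Complex.exp (c * a) * ∫ t : ℝ, Complex.exp (-c * t) * f t ∧
      freeSolDeriv c f a = c * freeSol c f a := by
  have h (d : ℂ) : ∫ t in (0 : ℝ)..a, Complex.exp (d * t) * f t =
      ∫ t : ℝ, Complex.exp (d * t) * f t := by
    rw [← (integral_Iic_cexp_mul d hf h0 a).2]
    exact setIntegral_eq_integral_of_forall_compl_eq_zero fun t ht => by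
      rw [ha t (not_le.1 ht), mul_zero]
  simp only [freeSol, freeSolDeriv, h]
  constructor <;> ring

end FreeSol

end IndefiniteGraph

namespace IndefiniteGraph

/-! ### Resolvents of self-adjoint operators -/

section Resolvent

variable {H : Type*} [NormedAddCommGroup H] [InnerProductSpace ℂ H] [CompleteSpace H]
  {T : H →ₗ.[ℂ] H}

/-- By symmetry `⟪u, T u⟫` is real, so `⟪u, (T - z) u⟫` has imaginary part `-Im z ‖u‖²`;
Cauchy–Schwarz concludes. -/
theorem abs_im_mul_norm_le (hT : IsSelfAdjoint T) (z : ℂ) (u : T.domain) :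
    |z.im| * ‖(u : H)‖ ≤ ‖T u - z • (u : H)‖ := by
  have hsym : inner ℂ (T u) (u : H) = inner ℂ (u : H) (T u) := by
    have h := LinearPMap.adjoint_isFormalAdjoint hT.dense_domain
    rw [LinearPMap.isSelfAdjoint_def.1 hT] at h
    exact h u u
  have hre : (inner ℂ (u : H) (T u)).im = 0 := by
    rw [← Complex.conj_eq_iff_im, inner_conj_symm, hsym]
  have him : (inner ℂ (u : H) (T u - z • (u : H))).im = -(z.im * ‖(u : H)‖ ^ 2) := by
    have hn : inner ℂ (u : H) (u : H) = ((‖(u : H)‖ ^ 2 : ℝ) : ℂ) :=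
      (inner_self_eq_norm_sq_to_K _).trans (by push_cast; rfl)
    rw [inner_sub_right, inner_smul_right, hn, Complex.sub_im, hre, zero_sub,
      Complex.im_mul_ofReal]
  have h1 := (Complex.abs_im_le_norm _).trans (norm_inner_le_norm (𝕜 := ℂ) (u : H)
    (T u - z • (u : H)))
  rw [him, abs_neg, abs_mul, abs_of_nonneg (sq_nonneg ‖(u : H)‖)] at h1
  -- Cauchy–Schwarz leaves a factor `‖u‖` on both sides, which can be cancelled unless it is zero.
  rcases (norm_nonneg (u : H)).eq_or_lt with h0 | h0
  · rw [← h0, mul_zero]; exact norm_nonneg _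
  · refine le_of_mul_le_mul_left ?_ h0
    linarith

theorem eq_zero_of_apply_eq_smul (hT : IsSelfAdjoint T) {z : ℂ} (hz : z.im ≠ 0) (u : T.domain)
    (h : T u = z • (u : H)) : (u : H) = 0 := by
  have h1 := abs_im_mul_norm_le hT z u
  rw [h, sub_self, norm_zero] at h1
  have h2 : 0 < |z.im| := abs_pos.2 hz
  exact norm_le_zero_iff.1 (nonpos_of_mul_nonpos_right h1 h2)

/-- If `T - z` is onto for a nonreal `z`, then `z` belongs to the resolvent set. -/
theorem exists_isResolventAt (hT : IsSelfAdjoint T) {z : ℂ} (hz : z.im ≠ 0)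
    (hs : ∀ f : H, ∃ u : T.domain, T u - z • (u : H) = f) :
    ∃ R : H →L[ℂ] H, IsResolventAt T z R := by
  let L : T.domain →ₗ[ℂ] H := T.toFun - z • T.domain.subtype
  have hL : ∀ u, L u = T u - z • (u : H) := fun u => rfl
  have hinj : Function.Injective L := by
    rw [← LinearMap.ker_eq_bot, LinearMap.ker_eq_bot']
    intro u hu
    rw [hL, sub_eq_zero] at hu
    exact Subtype.ext (eq_zero_of_apply_eq_smul hT hz u hu)
  let e := LinearEquiv.ofBijective L ⟨hinj, hs⟩
  have he : ∀ f, T (e.symm f) - z • (e.symm f : H) = f := fun f => e.apply_symm_apply f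
  refine ⟨(T.domain.subtype ∘ₗ e.symm.toLinearMap).mkContinuous |z.im|⁻¹ fun f => ?_,
    fun f => ⟨(e.symm f).2, he f⟩, fun u => ?_⟩
  · have h1 := abs_im_mul_norm_le hT z (e.symm f)
    rw [he] at h1
    rw [inv_mul_eq_div, le_div_iff₀ (abs_pos.2 hz), mul_comm]
    exact h1
  · change ((e.symm (e u) : T.domain) : H) = u
    rw [e.symm_apply_apply]

end Resolvent

namespace SignedMetricGraph

variable {V Ep Em Ip Im : Type*}

/-! ### Edgewise data -/

/-- The edge to which a boundary index belongs. -/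
def edgeOf : BIdx Ep Em Ip Im → Edge Ep Em Ip Im
  | Sum.inl (Sum.inl e) => Sum.inl (Sum.inl e)
  | Sum.inl (Sum.inr (Sum.inl i)) => Sum.inl (Sum.inr i)
  | Sum.inl (Sum.inr (Sum.inr i)) => Sum.inl (Sum.inr i)
  | Sum.inr (Sum.inl e) => Sum.inr (Sum.inl e)
  | Sum.inr (Sum.inr (Sum.inl i)) => Sum.inr (Sum.inr i)
  | Sum.inr (Sum.inr (Sum.inr i)) => Sum.inr (Sum.inr i)

/-- The exponent of the exponential function that belongs to a boundary index. -/
def bdryExp (k k' : ℂ) : BIdx Ep Em Ip Im → ℂ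
  | Sum.inl (Sum.inl _) => Complex.I * k
  | Sum.inl (Sum.inr (Sum.inl _)) => Complex.I * k
  | Sum.inl (Sum.inr (Sum.inr _)) => -(Complex.I * k)
  | Sum.inr (Sum.inl _) => Complex.I * k'
  | Sum.inr (Sum.inr (Sum.inl _)) => Complex.I * k'
  | Sum.inr (Sum.inr (Sum.inr _)) => -(Complex.I * k')

/-- The decaying exponent on an edge. -/
def edgeExp (k k' : ℂ) : Edge Ep Em Ip Im → ℂ
  | Sum.inl _ => Complex.I * k
  | Sum.inr _ => Complex.I * k'

/-- The diagonal entries of `W`. -/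
noncomputable def weight (k k' : ℂ) : Edge Ep Em Ip Im → ℂ
  | Sum.inl _ => Complex.I / (2 * k)
  | Sum.inr _ => Complex.I / (2 * k')

theorem edgeExp_re_neg {k k' : ℂ} (hk : 0 < k.im) (hk' : 0 < k'.im) (j : Edge Ep Em Ip Im) :
    (edgeExp k k' j).re < 0 := by
  rcases j with j | j <;> simpa [edgeExp]

theorem two_mul_edgeExp_mul_weight {k k' : ℂ} (hk : k ≠ 0) (hk' : k' ≠ 0)
    (j : Edge Ep Em Ip Im) : 2 * edgeExp k k' j * weight k k' j = -1 := by
  rcases j with j | j <;> simp only [edgeExp, weight] <;> field_simp <;> simp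

theorem tauSign_mul_edgeExp_sq {k k' : ℂ} (h : k' ^ 2 = -k ^ 2) (j : Edge Ep Em Ip Im) :
    tauSign j * edgeExp k k' j ^ 2 = k ^ 2 := by
  rcases j with j | j <;> simp [edgeExp, tauSign, mul_pow, h]

theorem tauSign_mul_bdryExp_sq {k k' : ℂ} (h : k' ^ 2 = -k ^ 2) (b : BIdx Ep Em Ip Im) :
    tauSign (edgeOf b) * bdryExp k k' b ^ 2 = k ^ 2 := by
  rcases b with (_ | _ | _) | (_ | _ | _) <;> simp [bdryExp, edgeOf, tauSign, mul_pow, h]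

theorem tauSign_sq (j : Edge Ep Em Ip Im) : tauSign j * tauSign j = 1 := by
  rcases j with j | j <;> simp [tauSign]

theorem interval_subset_Ici (Γ : SignedMetricGraph V Ep Em Ip Im) (j : Edge Ep Em Ip Im) :
    Γ.interval j ⊆ Ici 0 := by
  rcases j with (e | i) | (e | i)
  exacts [subset_rfl, Icc_subset_Ici_self, subset_rfl, Icc_subset_Ici_self]

/-- External edges carry only the decaying exponential; on a compact internal edge both exponentials
are bounded. -/
theorem memLp_cexp_bdryExp (Γ : SignedMetricGraph V Ep Em Ip Im) {k k' : ℂ} (hk : 0 < k.im)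
    (hk' : 0 < k'.im) (b : BIdx Ep Em Ip Im) :
    MemLp (fun x : ℝ => Complex.exp (bdryExp k k' b * x)) 2
      (volume.restrict (Γ.interval (edgeOf b))) := by
  have hc : ∀ (c : ℂ) (a : ℝ), MemLp (fun x : ℝ => Complex.exp (c * x)) 2
      (volume.restrict (Icc 0 a)) := by
    intro c a
    have hcont : Continuous fun x : ℝ => Complex.exp (c * x) := by fun_prop
    obtain ⟨C, hC⟩ := (isCompact_Icc (a := 0) (b := a)).exists_bound_of_continuousOn
      hcont.continuousOn
    exact MemLp.of_bound hcont.aestronglyMeasurable C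
      ((ae_restrict_mem measurableSet_Icc).mono hC)
  rcases b with (_ | _ | _) | (_ | _ | _)
  exacts [memLp_two_cexp_Ici (by simpa [bdryExp]), hc _ _, hc _ _,
    memLp_two_cexp_Ici (by simpa [bdryExp]), hc _ _, hc _ _]

/-! ### Boundary values -/

theorem bdryVal_add (Γ : SignedMetricGraph V Ep Em Ip Im) (ψ φ : Edge Ep Em Ip Im → ℝ → ℂ) :
    Γ.bdryVal (fun j x => ψ j x + φ j x) = Γ.bdryVal ψ + Γ.bdryVal φ := by
  funext b; rcases b with (_ | _ | _) | (_ | _ | _) <;> simp [bdryVal]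

theorem bdryDeriv_add (Γ : SignedMetricGraph V Ep Em Ip Im) (ψ φ : Edge Ep Em Ip Im → ℝ → ℂ) :
    Γ.bdryDeriv (fun j x => ψ j x + φ j x) = Γ.bdryDeriv ψ + Γ.bdryDeriv φ := by
  funext b; rcases b with (_ | _ | _) | (_ | _ | _) <;> simp [bdryDeriv] <;> ring

theorem bdryVal_eq_zero (Γ : SignedMetricGraph V Ep Em Ip Im) {ψ : Edge Ep Em Ip Im → ℝ → ℂ}
    (h : ∀ j, EqOn (ψ j) (fun _ => 0) (Γ.interval j)) : Γ.bdryVal ψ = 0 := by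
  funext b
  rcases b with (_ | i | i) | (_ | i | i)
  exacts [h _ self_mem_Ici, h _ (left_mem_Icc.2 (Γ.lenP_pos i).le),
    h _ (right_mem_Icc.2 (Γ.lenP_pos i).le), h _ self_mem_Ici,
    h _ (left_mem_Icc.2 (Γ.lenM_pos i).le), h _ (right_mem_Icc.2 (Γ.lenM_pos i).le)]

theorem bdryDeriv_eq_zero (Γ : SignedMetricGraph V Ep Em Ip Im) {ψ : Edge Ep Em Ip Im → ℝ → ℂ}
    (h : ∀ j, EqOn (ψ j) (fun _ => 0) (Γ.interval j)) : Γ.bdryDeriv ψ = 0 := by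
  funext b
  rcases b with (_ | i | i) | (_ | i | i)
  exacts [h _ self_mem_Ici, h _ (left_mem_Icc.2 (Γ.lenP_pos i).le),
    neg_eq_zero.2 (h _ (right_mem_Icc.2 (Γ.lenP_pos i).le)), h _ self_mem_Ici,
    h _ (left_mem_Icc.2 (Γ.lenM_pos i).le),
    neg_eq_zero.2 (h _ (right_mem_Icc.2 (Γ.lenM_pos i).le))]

theorem exists_hilb (Γ : SignedMetricGraph V Ep Em Ip Im) {ψ : Edge Ep Em Ip Im → ℝ → ℂ}
    (h : ∀ j, MemLp (ψ j) 2 (volume.restrict (Γ.interval j))) :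
    ∃ u : Γ.Hilb, ∀ j, u j =ᵐ[volume.restrict (Γ.interval j)] ψ j :=
  ⟨WithLp.toLp 2 fun j => (h j).toLp, fun j => (h j).coeFn_toLp⟩

/-! ### Entries of the matrices -/

section Entries

variable [DecidableEq Ep] [DecidableEq Em] [DecidableEq Ip] [DecidableEq Im]

/-- Encodes the block structure in `edgeOf` and `bdryExp`, so that later sums over boundary indices
avoid case distinctions on blocks. -/
theorem Phi_apply (x : ℝ) (k k' : ℂ) (j : Edge Ep Em Ip Im) (b : BIdx Ep Em Ip Im) :
    (Phi x k k' : Matrix (Edge Ep Em Ip Im) (BIdx Ep Em Ip Im) ℂ) j b =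
      if j = edgeOf b then Complex.exp (bdryExp k k' b * x) else 0 := by
  rcases j with (_ | _) | (_ | _) <;> rcases b with (_ | _ | _) | (_ | _ | _) <;>
    simp [Phi, matPhi, expDiag, Matrix.diagonal_apply, edgeOf, bdryExp, Matrix.fromCols]

theorem W_eq_diagonal (k k' : ℂ) :
    (W k k' : Matrix (Edge Ep Em Ip Im) (Edge Ep Em Ip Im) ℂ) =
      Matrix.diagonal (weight k k') := by
  ext i j
  rcases i with i | i <;> rcases j with j | j <;>
    simp [W, weight, Matrix.diagonal_apply, Matrix.one_apply]

end Entries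

variable [Fintype Ep] [Fintype Em] [Fintype Ip] [Fintype Im]

theorem exists_apply_eq_of_TRel (Γ : SignedMetricGraph V Ep Em Ip Im)
    {A B : Matrix (BIdx Ep Em Ip Im) (BIdx Ep Em Ip Im) ℂ} {f g : Γ.Hilb}
    (h : Γ.TRel A B f g) : ∃ hf : f ∈ (Γ.T A B).domain, Γ.T A B ⟨f, hf⟩ = g := by
  have h1 := (Γ.mem_graph_T_iff A B (f, g)).2 h
  obtain ⟨y, hy, hg⟩ := (LinearPMap.mem_graph_iff _).1 h1
  obtain rfl : (y : Γ.Hilb) = f := hy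
  exact ⟨y.2, hg⟩

variable [DecidableEq Ep] [DecidableEq Em] [DecidableEq Ip] [DecidableEq Im]

theorem r0_apply (x y : ℝ) (k k' : ℂ) (j j' : Edge Ep Em Ip Im) :
    (r0 x y k k' : Matrix (Edge Ep Em Ip Im) (Edge Ep Em Ip Im) ℂ) j j' =
      if j = j' then -tauSign j * weight k k' j * Complex.exp (edgeExp k k' j * (|x - y| : ℝ))
      else 0 := by
  rw [r0, W_eq_diagonal, Matrix.mul_diagonal]
  rcases j with j | j <;> rcases j' with j' | j' <;>
    simp [edgeExp, tauSign, Matrix.one_apply, weight, mul_comm]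
  split_ifs <;> simp

theorem expDiag_mul_expDiag_neg {I : Type*} [Fintype I] [DecidableEq I] (k : ℂ) (b : I → ℝ) :
    expDiag k b * expDiag (-k) b = 1 := by
  rw [expDiag, expDiag, Matrix.diagonal_mul_diagonal, ← Matrix.diagonal_one]
  congr 1
  funext i
  rw [← Complex.exp_add]
  simp

theorem isUnit_det_Rp (Γ : SignedMetricGraph V Ep Em Ip Im) (k k' : ℂ) :
    IsUnit (Γ.Rp k k').det := by
  -- `R⁺` is a diagonal matrix of ones and exponentials, inverted by changing the signs of `k` and
  -- `k'`.
  refine Matrix.isUnit_det_of_left_inverse (B := Γ.Rp (-k) (-k')) ?_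
  simp [Rp, matRp, Matrix.fromBlocks_multiply, expDiag_mul_expDiag_neg, Matrix.fromBlocks_one]

/-! ### Superpositions of exponential functions -/

/-- The function `Φ(x) u`. -/
noncomputable def wave (k k' : ℂ) (u : BIdx Ep Em Ip Im → ℂ) (j : Edge Ep Em Ip Im) (x : ℝ) : ℂ :=
  ∑ b, if j = edgeOf b then u b * Complex.exp (bdryExp k k' b * x) else 0

/-- The derivative of `Φ(x) u`. -/
noncomputable def waveDeriv (k k' : ℂ) (u : BIdx Ep Em Ip Im → ℂ) (j : Edge Ep Em Ip Im)
    (x : ℝ) : ℂ :=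
  ∑ b, if j = edgeOf b then u b * (bdryExp k k' b * Complex.exp (bdryExp k k' b * x)) else 0

theorem wave_eq_mulVec (k k' : ℂ) (u : BIdx Ep Em Ip Im → ℂ) (j : Edge Ep Em Ip Im) (x : ℝ) :
    wave k k' u j x =
      (Phi x k k' : Matrix (Edge Ep Em Ip Im) (BIdx Ep Em Ip Im) ℂ).mulVec u j := by
  simp only [wave, Matrix.mulVec, dotProduct, Phi_apply]
  refine Finset.sum_congr rfl fun b _ => ?_
  split_ifs <;> simp [mul_comm]

/-- The sign of `τ` squares to 1, so this form of the second derivative says `τψ = k²ψ`; on negative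
edges this uses `k'² = -k²`. -/
theorem isDe_wave (Γ : SignedMetricGraph V Ep Em Ip Im) {k k' : ℂ} (hk : 0 < k.im)
    (hk' : 0 < k'.im) (h : k' ^ 2 = -k ^ 2) (u : BIdx Ep Em Ip Im → ℂ) (j : Edge Ep Em Ip Im) :
    IsDe (Γ.interval j) (wave k k' u j) (waveDeriv k k' u j)
      (fun x => tauSign j * (k ^ 2 * wave k k' u j x)) := by
  have hs : ∀ b ∈ Finset.univ, IsDe (Γ.interval j)
      (fun x => if j = edgeOf b then u b * Complex.exp (bdryExp k k' b * x) else 0)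
      (fun x => if j = edgeOf b then
        u b * (bdryExp k k' b * Complex.exp (bdryExp k k' b * x)) else 0)
      (fun x => if j = edgeOf b then u b * (bdryExp k k' b *
        (bdryExp k k' b * Complex.exp (bdryExp k k' b * x))) else 0) := by
    intro b _
    by_cases hb : j = edgeOf b
    · subst hb
      simpa using (isDe_cexp (Γ.memLp_cexp_bdryExp hk hk' b)).const_mul (u b)
    · simpa [hb] using IsDe.zero _
  have hw := IsDe.sum Finset.univ hs
  suffices h2 : (fun x => tauSign j * (k ^ 2 * wave k k' u j x)) = fun x : ℝ => ∑ b,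
      if j = edgeOf b then u b * (bdryExp k k' b *
        (bdryExp k k' b * Complex.exp (bdryExp k k' b * x))) else 0 by
    rw [h2]
    exact hw
  funext x
  rw [wave, Finset.mul_sum, Finset.mul_sum]
  refine Finset.sum_congr rfl fun b _ => ?_
  split_ifs with hb
  · subst hb
    linear_combination (-tauSign (edgeOf b) * u b * Complex.exp (bdryExp k k' b * x)) *
      tauSign_mul_bdryExp_sq h b + (u b * Complex.exp (bdryExp k k' b * x) * bdryExp k k' b ^ 2) *
      tauSign_sq (edgeOf b)
  · simp

theorem bdryVal_wave (Γ : SignedMetricGraph V Ep Em Ip Im) (k k' : ℂ) (u : BIdx Ep Em Ip Im → ℂ) :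
    Γ.bdryVal (wave k k' u) = (Γ.X k k').mulVec u := by
  funext b
  rcases b with (_ | _ | _) | (_ | _ | _) <;>
    simp [bdryVal, wave, X, matX, expDiag, edgeOf, bdryExp, Matrix.mulVec, dotProduct,
      Fintype.sum_sum_type, Matrix.one_apply, Matrix.diagonal_apply, mul_comm]

theorem bdryDeriv_wave (Γ : SignedMetricGraph V Ep Em Ip Im) (k k' : ℂ)
    (u : BIdx Ep Em Ip Im → ℂ) :
    Γ.bdryDeriv (waveDeriv k k' u) = (Γ.Y k k').mulVec u := by
  funext b
  rcases b with (_ | _ | _) | (_ | _ | _) <;>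
    simp [bdryDeriv, waveDeriv, Y, matY, expDiag, edgeOf, bdryExp, Matrix.mulVec, dotProduct,
      Fintype.sum_sum_type, Matrix.one_apply, Matrix.diagonal_apply, mul_comm, mul_left_comm,
      add_comm]

end SignedMetricGraph

end IndefiniteGraph

namespace IndefiniteGraph

namespace SignedMetricGraph

variable {V Ep Em Ip Im : Type*}

/-- The component of `f` on the edge `j`, extended by zero. -/
noncomputable def extend (Γ : SignedMetricGraph V Ep Em Ip Im) (f : Γ.Hilb)
    (j : Edge Ep Em Ip Im) : ℝ → ℂ :=
  (Γ.interval j).indicator (f j)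

section Extend

variable (Γ : SignedMetricGraph V Ep Em Ip Im) (f : Γ.Hilb) (j : Edge Ep Em Ip Im)

theorem memLp_extend : MemLp (Γ.extend f j) 2 volume :=
  (memLp_indicator_iff_restrict (Γ.interval_props j).2.1).2 (Lp.memLp (f j))

theorem extend_eq_zero {t : ℝ} (ht : t ∉ Γ.interval j) : Γ.extend f j t = 0 :=
  indicator_of_notMem ht _

theorem extend_neg {t : ℝ} (ht : t < 0) : Γ.extend f j t = 0 :=
  Γ.extend_eq_zero f j fun h => (not_le.2 ht) (Γ.interval_subset_Ici j h)

theorem integral_mul_extend (g : ℝ → ℂ) :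
    ∫ t, g t * Γ.extend f j t = ∫ t in Γ.interval j, g t * f j t := by
  rw [← integral_indicator (Γ.interval_props j).2.1]
  refine integral_congr_ae (Filter.Eventually.of_forall fun t => ?_)
  by_cases ht : t ∈ Γ.interval j <;> simp [extend, ht]

end Extend

/-! ### The free part of the resolvent -/

/-- The function with components `∫ r⁰(x, y) f(y) dy`. -/
noncomputable def freePart (Γ : SignedMetricGraph V Ep Em Ip Im) (k k' : ℂ) (f : Γ.Hilb)
    (j : Edge Ep Em Ip Im) (x : ℝ) : ℂ :=
  -tauSign j * weight k k' j * freeSol (edgeExp k k' j) (Γ.extend f j) x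

/-- The derivative of `freePart`. -/
noncomputable def freePartDeriv (Γ : SignedMetricGraph V Ep Em Ip Im) (k k' : ℂ) (f : Γ.Hilb)
    (j : Edge Ep Em Ip Im) (x : ℝ) : ℂ :=
  -tauSign j * weight k k' j * freeSolDeriv (edgeExp k k' j) (Γ.extend f j) x

/-- The vector with components `∫ (Φ(y)ᵀ W f(y))_b dy`. -/
noncomputable def source (Γ : SignedMetricGraph V Ep Em Ip Im) (k k' : ℂ) (f : Γ.Hilb)
    (b : BIdx Ep Em Ip Im) : ℂ :=
  weight k k' (edgeOf b) *
    ∫ t : ℝ, Complex.exp (bdryExp k k' b * t) * Γ.extend f (edgeOf b) t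

/-- The second derivative expresses `τψ = k²ψ + f`. With `c` the decaying exponent, the weight is
`-1/(2c)`, which turns the source `2 c f` of `freeSol` into `-f`; the factor `-tauSign j` gives it
the sign required by `τ`. -/
theorem isDe_freePart (Γ : SignedMetricGraph V Ep Em Ip Im) {k k' : ℂ} (hk : 0 < k.im)
    (hk' : 0 < k'.im) (h : k' ^ 2 = -k ^ 2) (f : Γ.Hilb) (j : Edge Ep Em Ip Im) :
    IsDe (Γ.interval j) (Γ.freePart k k' f j) (Γ.freePartDeriv k k' f j)
      (fun x => tauSign j * (k ^ 2 * Γ.freePart k k' f j x + Γ.extend f j x)) := by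
  have h1 := (isDe_freeSol (edgeExp_re_neg hk hk' j) (Γ.memLp_extend f j)
    (fun t ht => Γ.extend_neg f j ht) (Γ.interval_props j).2.1).const_mul
    (-tauSign j * weight k k' j)
  suffices h2 : (fun x => tauSign j * (k ^ 2 * Γ.freePart k k' f j x + Γ.extend f j x)) =
      fun x => -tauSign j * weight k k' j * (edgeExp k k' j ^ 2 *
        freeSol (edgeExp k k' j) (Γ.extend f j) x + 2 * edgeExp k k' j * Γ.extend f j x) by
    rw [h2]
    exact h1
  funext x
  have e1 := two_mul_edgeExp_mul_weight (k := k) (k' := k') (by rintro rfl; simp at hk)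
    (by rintro rfl; simp at hk') j
  have e2 := tauSign_mul_edgeExp_sq h j
  have e3 := tauSign_sq j
  rw [freePart]
  linear_combination tauSign j * Γ.extend f j x * e1 +
    (tauSign j * tauSign j * weight k k' j * freeSol (edgeExp k k' j) (Γ.extend f j) x) * e2 -
    (tauSign j * weight k k' j * edgeExp k k' j ^ 2 *
      freeSol (edgeExp k k' j) (Γ.extend f j) x) * e3

variable [DecidableEq Ep] [DecidableEq Em] [DecidableEq Ip] [DecidableEq Im]

theorem integrable_cexp_bdryExp_mul (Γ : SignedMetricGraph V Ep Em Ip Im) {k k' : ℂ}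
    (hk : 0 < k.im) (hk' : 0 < k'.im) (f : Γ.Hilb) (j : Edge Ep Em Ip Im)
    (b : BIdx Ep Em Ip Im) :
    IntegrableOn (fun y : ℝ => (if j = edgeOf b then Complex.exp (bdryExp k k' b * y) else 0) *
      weight k k' j * f j y) (Γ.interval j) := by
  split_ifs with h
  · subst h
    exact ((Γ.memLp_cexp_bdryExp hk hk' b).mul_const _).integrable_mul (Lp.memLp (f (edgeOf b)))
  · simp

theorem integrable_free_mul (Γ : SignedMetricGraph V Ep Em Ip Im) {k k' : ℂ}
    (hk : 0 < k.im) (hk' : 0 < k'.im) (f : Γ.Hilb) (j j' : Edge Ep Em Ip Im) (x : ℝ) :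
    IntegrableOn (fun y : ℝ => (if j = j' then -tauSign j * weight k k' j *
      Complex.exp (edgeExp k k' j * (|x - y| : ℝ)) else 0) * f j' y) (Γ.interval j') := by
  split_ifs with h
  · subst h
    exact (((memLp_two_cexp_mul_abs (edgeExp_re_neg hk hk' j) x).restrict _).const_mul
      _).integrable_mul (Lp.memLp (f j))
  · simp

variable [Fintype Ep] [Fintype Em] [Fintype Ip] [Fintype Im]

/-- The extended `f` vanishes beyond the end points of the edge, so the free solution is purely
outgoing there. -/
theorem bdryDeriv_freePart (Γ : SignedMetricGraph V Ep Em Ip Im) (k k' : ℂ) (f : Γ.Hilb) :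
    Γ.bdryDeriv (Γ.freePartDeriv k k' f) =
      (matI (-k) (-k')).mulVec (Γ.bdryVal (Γ.freePart k k' f)) := by
  have hR (j) (a : ℝ) (ha : ∀ t, a < t → Γ.extend f j t = 0) :=
    (freeSol_right (edgeExp k k' j) (Γ.memLp_extend f j) (fun t ht => Γ.extend_neg f j ht) ha).2
  have hP (i) := hR (Sum.inl (Sum.inr i)) (Γ.lenP i) fun t ht =>
    Γ.extend_eq_zero f _ fun h => (not_le.2 ht) h.2
  have hM (i) := hR (Sum.inr (Sum.inr i)) (Γ.lenM i) fun t ht =>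
    Γ.extend_eq_zero f _ fun h => (not_le.2 ht) h.2
  funext b
  rcases b with (_ | _ | _) | (_ | _ | _) <;>
    simp [bdryDeriv, bdryVal, matI, freePart, freePartDeriv, Matrix.mulVec, dotProduct,
      freeSolDeriv_zero, hP, hM, Fintype.sum_sum_type, Matrix.one_apply] <;>
    simp only [edgeExp] <;> ring

/-- Up to the prefactor, the value at an end point `a` is `exp (c a)` times the integral of `exp (-c
t) f`, where `c` is the decaying exponent, and `R⁺` removes `exp (c a)`. At initial points there is
nothing to remove. The matrix `J` collects the signs `-tauSign j`. -/
theorem Rp_mulVec_bdryVal_freePart (Γ : SignedMetricGraph V Ep Em Ip Im) (k k' : ℂ)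
    (f : Γ.Hilb) :
    (Γ.Rp k k').mulVec (Γ.bdryVal (Γ.freePart k k' f)) =
      (matJ : Matrix (BIdx Ep Em Ip Im) (BIdx Ep Em Ip Im) ℂ).mulVec (Γ.source k k' f) := by
  have hR (j) (a : ℝ) (ha : ∀ t, a < t → Γ.extend f j t = 0) :
      Complex.exp (-edgeExp k k' j * a) * freeSol (edgeExp k k' j) (Γ.extend f j) a =
        ∫ t : ℝ, Complex.exp (-edgeExp k k' j * t) * Γ.extend f j t := by
    rw [(freeSol_right (edgeExp k k' j) (Γ.memLp_extend f j)
      (fun t ht => Γ.extend_neg f j ht) ha).1, ← mul_assoc, ← Complex.exp_add]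
    simp
  have hP (i) := hR (Sum.inl (Sum.inr i)) (Γ.lenP i) fun t ht =>
    Γ.extend_eq_zero f _ fun h => (not_le.2 ht) h.2
  have hM (i) := hR (Sum.inr (Sum.inr i)) (Γ.lenM i) fun t ht =>
    Γ.extend_eq_zero f _ fun h => (not_le.2 ht) h.2
  simp only [edgeExp, neg_mul] at hP hM
  funext b
  rcases b with (_ | _ | i) | (_ | _ | i)
  case inl.inr.inr =>
    simp [bdryVal, Rp, matRp, matJ, freePart, source, expDiag, edgeOf, bdryExp, tauSign, edgeExp,
      weight, Matrix.mulVec, dotProduct, Fintype.sum_sum_type, Matrix.one_apply,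
      Matrix.diagonal_apply]
    linear_combination (Complex.I / (2 * k)) * hP i
  case inr.inr.inr =>
    simp [bdryVal, Rp, matRp, matJ, freePart, source, expDiag, edgeOf, bdryExp, tauSign, edgeExp,
      weight, Matrix.mulVec, dotProduct, Fintype.sum_sum_type, Matrix.one_apply,
      Matrix.diagonal_apply]
    linear_combination (Complex.I / (2 * k')) * hM i
  all_goals
    simp [bdryVal, Rp, matRp, matJ, freePart, source, edgeOf, bdryExp, tauSign, edgeExp,
      freeSol_zero, Matrix.mulVec, dotProduct, Fintype.sum_sum_type, Matrix.one_apply]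

/-! ### Invertibility of `Z` -/

/-- The rows at the initial points suffice: on an internal edge they give `α + β = 0` and `ik(α - β)
= 0` (with `k'` on negative edges), on an external edge the row of `X` is the coefficient itself. -/
theorem eq_zero_of_X_mulVec_of_Y_mulVec (Γ : SignedMetricGraph V Ep Em Ip Im) {k k' : ℂ}
    (hk : k ≠ 0) (hk' : k' ≠ 0) {u : BIdx Ep Em Ip Im → ℂ} (hX : (Γ.X k k').mulVec u = 0)
    (hY : (Γ.Y k k').mulVec u = 0) : u = 0 := by
  have h2 : ∀ a b : ℂ, a + b = 0 → a + -b = 0 → a = 0 ∧ b = 0 := fun a b h1 h2 =>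
    ⟨by linear_combination (h1 + h2) / 2, by linear_combination (h1 - h2) / 2⟩
  have hP (i : Ip) : u (Sum.inl (Sum.inr (Sum.inl i))) = 0 ∧
      u (Sum.inl (Sum.inr (Sum.inr i))) = 0 := by
    have e1 := congrFun hX (Sum.inl (Sum.inr (Sum.inl i)))
    have e2 := congrFun hY (Sum.inl (Sum.inr (Sum.inl i)))
    simp [X, Y, matX, matY, Matrix.mulVec, dotProduct, Fintype.sum_sum_type,
      Matrix.one_apply] at e1 e2
    refine h2 _ _ e1 (mul_left_cancel₀ (mul_ne_zero Complex.I_ne_zero hk) ?_)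
    linear_combination e2
  have hM (i : Im) : u (Sum.inr (Sum.inr (Sum.inl i))) = 0 ∧
      u (Sum.inr (Sum.inr (Sum.inr i))) = 0 := by
    have e1 := congrFun hX (Sum.inr (Sum.inr (Sum.inl i)))
    have e2 := congrFun hY (Sum.inr (Sum.inr (Sum.inl i)))
    simp [X, Y, matX, matY, Matrix.mulVec, dotProduct, Fintype.sum_sum_type,
      Matrix.one_apply] at e1 e2
    refine h2 _ _ e1 (mul_left_cancel₀ (mul_ne_zero Complex.I_ne_zero hk') ?_)
    linear_combination e2
  funext b
  rcases b with (e | i | i) | (e | i | i)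
  · have e1 := congrFun hX (Sum.inl (Sum.inl e))
    simpa [X, matX, Matrix.mulVec, dotProduct, Fintype.sum_sum_type, Matrix.one_apply] using e1
  · exact (hP i).1
  · exact (hP i).2
  · have e1 := congrFun hX (Sum.inr (Sum.inl e))
    simpa [X, matX, Matrix.mulVec, dotProduct, Fintype.sum_sum_type, Matrix.one_apply] using e1
  · exact (hM i).1
  · exact (hM i).2

theorem isUnit_det_Z (Γ : SignedMetricGraph V Ep Em Ip Im)
    {A B : Matrix (BIdx Ep Em Ip Im) (BIdx Ep Em Ip Im) ℂ} (hT : IsSelfAdjoint (Γ.T A B))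
    {k k' : ℂ} (hk : 0 < k.im) (hk' : 0 < k'.im) (h : k' ^ 2 = -k ^ 2) (hz : (k ^ 2).im ≠ 0) :
    IsUnit (Γ.Z A B k k').det := by
  rw [isUnit_iff_ne_zero]
  intro hdet
  obtain ⟨v, hv, hZ⟩ := Matrix.exists_mulVec_eq_zero_iff.2 hdet
  have hDe := fun j => Γ.isDe_wave hk hk' h v j
  obtain ⟨u, hu⟩ := Γ.exists_hilb fun j => (hDe j).memLp
  -- A null vector of `Z` yields a wave that satisfies the boundary condition, so `T u = k² u`.
  have hrel : Γ.TRel A B u ((k ^ 2) • u) := by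
    refine ⟨_, _, _, hDe, hu, fun j => ?_, ?_⟩
    · filter_upwards [hu j, Lp.coeFn_smul (k ^ 2) (u j)] with x h1 h2
      rw [PiLp.smul_apply, h2, Pi.smul_apply, h1, ← mul_assoc, tauSign_sq, one_mul, smul_eq_mul]
    · rw [bdryVal_wave, bdryDeriv_wave, Matrix.mulVec_mulVec, Matrix.mulVec_mulVec,
        ← Matrix.add_mulVec]
      exact hZ
  obtain ⟨hd, hu2⟩ := Γ.exists_apply_eq_of_TRel hrel
  have hu0 : u = 0 := eq_zero_of_apply_eq_smul hT hz ⟨u, hd⟩ hu2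
  -- The wave vanishes almost everywhere and is continuous, so it vanishes at the end points too,
  -- and so does its one-sided derivative.
  have e1 : ∀ j, EqOn (wave k k' v j) (fun _ => 0) (Γ.interval j) := by
    intro j
    obtain ⟨hU, hM, hC⟩ := Γ.interval_props j
    have e0 : wave k k' v j =ᵐ[volume.restrict (Γ.interval j)] fun _ => 0 := by
      have h1 := hu j
      rw [hu0] at h1
      exact h1.symm.trans (Lp.coeFn_zero ℂ 2 (volume.restrict (Γ.interval j)))
    exact Measure.eqOn_of_ae_eq e0 (fun x hx => ((hDe j).hasDeriv x hx).continuousWithinAt)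
      continuousOn_const hC
  have e2 : ∀ j, EqOn (waveDeriv k k' v j) (fun _ => 0) (Γ.interval j) := fun j x hx =>
    ((Γ.interval_props j).1 x hx).eq_deriv _ ((hDe j).hasDeriv x hx)
      ((hasDerivWithinAt_const x _ (0 : ℂ)).congr (e1 j) (e1 j hx))
  have hk0 : k ≠ 0 := by rintro rfl; simp at hk
  have hk0' : k' ≠ 0 := by rintro rfl; simp at hk'
  refine hv (Γ.eq_zero_of_X_mulVec_of_Y_mulVec hk0 hk0' ?_ ?_)
  · rw [← bdryVal_wave]
    exact Γ.bdryVal_eq_zero e1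
  · rw [← bdryDeriv_wave]
    exact Γ.bdryDeriv_eq_zero e2

/-! ### The integral kernel -/

/-- Separates the dependence of `r¹` on `x` and `y`: a finite sum of products, handled termwise for
measurability, integrability and integration in `y`. -/
theorem kernel_eq (Γ : SignedMetricGraph V Ep Em Ip Im)
    (A B : Matrix (BIdx Ep Em Ip Im) (BIdx Ep Em Ip Im) ℂ) (k k' : ℂ) (j j' : Edge Ep Em Ip Im)
    (x y : ℝ) :
    Γ.kernel A B k k' j j' x y =
      (if j = j' then -tauSign j * weight k k' j * Complex.exp (edgeExp k k' j * (|x - y| : ℝ))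
        else 0) +
      ∑ b, ((Phi x k k' : Matrix (Edge Ep Em Ip Im) (BIdx Ep Em Ip Im) ℂ) * Γ.G A B k k') j b *
        ((if j' = edgeOf b then Complex.exp (bdryExp k k' b * y) else 0) * weight k k' j') := by
  rw [kernel, r0_apply, r1, W_eq_diagonal, Matrix.mul_diagonal, Matrix.mul_apply, Finset.sum_mul]
  simp only [Matrix.transpose_apply, Phi_apply, mul_assoc]

theorem measurable_comp_subtype_coe {g : ℝ × ℝ → ℂ} (hg : Measurable g) (s t : Set ℝ) :
    Measurable fun p : s × t => g (p.1, p.2) :=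
  hg.comp ((measurable_subtype_coe.comp measurable_fst).prodMk
    (measurable_subtype_coe.comp measurable_snd))

theorem measurable_kernel (Γ : SignedMetricGraph V Ep Em Ip Im)
    (A B : Matrix (BIdx Ep Em Ip Im) (BIdx Ep Em Ip Im) ℂ) (k k' : ℂ)
    (j j' : Edge Ep Em Ip Im) :
    Measurable fun p : Γ.interval j × Γ.interval j' => Γ.kernel A B k k' j j' p.1 p.2 := by
  have hexp (c : ℂ) (q : Prop) [Decidable q] :
      Measurable fun x : ℝ => if q then Complex.exp (c * x) else 0 := by
    split_ifs <;> fun_prop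
  have hfree : Measurable fun p : ℝ × ℝ => if j = j' then -tauSign j * weight k k' j *
      Complex.exp (edgeExp k k' j * (|p.1 - p.2| : ℝ)) else 0 := by
    split_ifs <;> fun_prop
  have hleft (b) : Measurable fun x : ℝ =>
      ((Phi x k k' : Matrix (Edge Ep Em Ip Im) (BIdx Ep Em Ip Im) ℂ) * Γ.G A B k k') j b := by
    simp only [Matrix.mul_apply, Phi_apply]
    exact Finset.measurable_sum _ fun b' _ => (hexp _ _).mul_const _
  have h : Measurable fun p : ℝ × ℝ => Γ.kernel A B k k' j j' p.1 p.2 := by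
    simp only [kernel_eq]
    exact hfree.add (Finset.measurable_sum _ fun b _ => ((hleft b).comp measurable_fst).mul
      (((hexp _ _).comp measurable_snd).mul_const _))
  exact measurable_comp_subtype_coe h _ _

theorem integrable_kernel_mul (Γ : SignedMetricGraph V Ep Em Ip Im)
    (A B : Matrix (BIdx Ep Em Ip Im) (BIdx Ep Em Ip Im) ℂ) {k k' : ℂ}
    (hk : 0 < k.im) (hk' : 0 < k'.im) (f : Γ.Hilb) (j j' : Edge Ep Em Ip Im) (x : ℝ) :
    IntegrableOn (fun y => Γ.kernel A B k k' j j' x y * f j' y) (Γ.interval j') := by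
  simp only [kernel_eq, add_mul, Finset.sum_mul, mul_assoc (_ : ℂ) (_ * _) (f j' _)]
  exact (Γ.integrable_free_mul hk hk' f j j' x).add (integrable_finsetSum _ fun b _ =>
    (Γ.integrable_cexp_bdryExp_mul hk hk' f j' b).const_mul _)

/-- Identifies the integral operator with the variation of constants solution plus a wave, on which
differentiation and boundary values are explicit. -/
theorem sum_integral_kernel_mul (Γ : SignedMetricGraph V Ep Em Ip Im)
    (A B : Matrix (BIdx Ep Em Ip Im) (BIdx Ep Em Ip Im) ℂ) {k k' : ℂ}
    (hk : 0 < k.im) (hk' : 0 < k'.im) (f : Γ.Hilb) (j : Edge Ep Em Ip Im) (x : ℝ) :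
    ∑ j', ∫ y in Γ.interval j', Γ.kernel A B k k' j j' x y * f j' y =
      Γ.freePart k k' f j x + wave k k' ((Γ.G A B k k').mulVec (Γ.source k k' f)) j x := by
  have hint : ∀ j', ∫ y in Γ.interval j', Γ.kernel A B k k' j j' x y * f j' y =
      (∫ y in Γ.interval j', (if j = j' then -tauSign j * weight k k' j *
        Complex.exp (edgeExp k k' j * (|x - y| : ℝ)) else 0) * f j' y) +
      ∑ b, ((Phi x k k' : Matrix (Edge Ep Em Ip Im) (BIdx Ep Em Ip Im) ℂ) * Γ.G A B k k') j b *
        ∫ y in Γ.interval j', (if j' = edgeOf b then Complex.exp (bdryExp k k' b * y) else 0) *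
          weight k k' j' * f j' y := by
    intro j'
    simp only [kernel_eq, add_mul, Finset.sum_mul, mul_assoc (_ : ℂ) (_ * _) (f j' _)]
    rw [integral_add (Γ.integrable_free_mul hk hk' f j j' x) (integrable_finsetSum _ fun b _ =>
      (Γ.integrable_cexp_bdryExp_mul hk hk' f j' b).const_mul _), integral_finsetSum _ fun b _ =>
      (Γ.integrable_cexp_bdryExp_mul hk hk' f j' b).const_mul _]
    simp only [integral_const_mul]
  have hsource (b : BIdx Ep Em Ip Im) : ∑ j', ∫ y in Γ.interval j',
      (if j' = edgeOf b then Complex.exp (bdryExp k k' b * y) else 0) *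
        weight k k' j' * f j' y = Γ.source k k' f b := by
    rw [Finset.sum_eq_single (edgeOf b) (fun j' _ h => by simp [h]) (by simp), source,
      integral_mul_extend, ← integral_const_mul]
    refine integral_congr_ae (Filter.Eventually.of_forall fun y => ?_)
    simp only [if_true]
    ring
  have hfree : ∑ j', ∫ y in Γ.interval j', (if j = j' then -tauSign j * weight k k' j *
      Complex.exp (edgeExp k k' j * (|x - y| : ℝ)) else 0) * f j' y = Γ.freePart k k' f j x := by
    rw [Finset.sum_eq_single j (fun j' _ h => by simp [h.symm]) (by simp), freePart,
      freeSol_eq_integral (edgeExp_re_neg hk hk' j) (Γ.memLp_extend f j)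
        (fun t ht => Γ.extend_neg f j ht), integral_mul_extend, ← integral_const_mul]
    refine integral_congr_ae (Filter.Eventually.of_forall fun y => ?_)
    simp only [if_true]
    ring
  simp only [hint]
  rw [Finset.sum_add_distrib, hfree, Finset.sum_comm, wave_eq_mulVec, Matrix.mulVec_mulVec]
  simp only [← Finset.mul_sum, hsource]
  rfl

/-! ### Solution of the resolvent equation -/

theorem exists_solution (Γ : SignedMetricGraph V Ep Em Ip Im)
    (A B : Matrix (BIdx Ep Em Ip Im) (BIdx Ep Em Ip Im) ℂ) {k k' : ℂ}
    (hk : 0 < k.im) (hk' : 0 < k'.im) (h : k' ^ 2 = -k ^ 2) (hZ : IsUnit (Γ.Z A B k k').det)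
    (f : Γ.Hilb) :
    ∃ u : Γ.Hilb, Γ.TRel A B u (f + (k ^ 2) • u) ∧
      ∀ j, u j =ᵐ[volume.restrict (Γ.interval j)]
        fun x => ∑ j', ∫ y in Γ.interval j', Γ.kernel A B k k' j j' x y * f j' y := by
  set v := (Γ.G A B k k').mulVec (Γ.source k k' f) with hv
  have hDe := fun j => (Γ.isDe_freePart hk hk' h f j).add (Γ.isDe_wave hk hk' h v j)
  obtain ⟨u, hu⟩ := Γ.exists_hilb fun j => (hDe j).memLp
  refine ⟨u, ⟨_, _, _, hDe, hu, fun j => ?_, ?_⟩, fun j => ?_⟩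
  · filter_upwards [hu j, Lp.coeFn_add (f j) ((k ^ 2) • u j), Lp.coeFn_smul (k ^ 2) (u j),
      ae_restrict_mem (Γ.interval_props j).2.1] with x h1 h2 h3 hx
    rw [PiLp.add_apply, PiLp.smul_apply, h2, Pi.add_apply, h3, Pi.smul_apply, h1, smul_eq_mul,
      extend, indicator_of_mem hx]
    linear_combination (-(k ^ 2 * (Γ.freePart k k' f j x + wave k k' v j x)) - f j x) *
      tauSign_sq j
  -- This explains the factor `(R⁺)⁻¹J` in `G`: it recovers the boundary values of the free part
  -- from the source integrals.
  · have hc : (Γ.Rp k k')⁻¹.mulVec (matJ.mulVec (Γ.source k k' f)) =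
        Γ.bdryVal (Γ.freePart k k' f) := by
      rw [← Rp_mulVec_bdryVal_freePart, Matrix.mulVec_mulVec,
        Matrix.nonsing_inv_mul _ (Γ.isUnit_det_Rp k k'), Matrix.one_mulVec]
    -- The contribution of the wave to the boundary condition is exactly opposite to that of the
    -- free part.
    have hZv : (Γ.Z A B k k').mulVec v =
        -(A + B * matI (-k) (-k')).mulVec (Γ.bdryVal (Γ.freePart k k' f)) := by
      rw [hv, G, ← Matrix.mulVec_mulVec, ← Matrix.mulVec_mulVec, hc, frakX,
        Matrix.mulVec_mulVec, Matrix.mul_neg, ← Matrix.mul_assoc, Matrix.mul_nonsing_inv _ hZ,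
        Matrix.one_mul, Matrix.neg_mulVec]
    rw [bdryVal_add, bdryDeriv_add, bdryVal_wave, bdryDeriv_wave, bdryDeriv_freePart]
    rw [Z, Matrix.add_mulVec, ← Matrix.mulVec_mulVec, ← Matrix.mulVec_mulVec, Matrix.add_mulVec,
      ← Matrix.mulVec_mulVec] at hZv
    rw [Matrix.mulVec_add, Matrix.mulVec_add, add_add_add_comm, hZv, add_neg_cancel]
  · filter_upwards [hu j] with x hx
    rw [hx, Γ.sum_integral_kernel_mul A B hk hk' f j x]

theorem exists_resolvent_isIntegralOperator (Γ : SignedMetricGraph V Ep Em Ip Im)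
    {A B : Matrix (BIdx Ep Em Ip Im) (BIdx Ep Em Ip Im) ℂ} (hT : IsSelfAdjoint (Γ.T A B))
    {k k' : ℂ} (hk : 0 < k.im) (hk' : 0 < k'.im) (h : k' ^ 2 = -k ^ 2) (hz : (k ^ 2).im ≠ 0) :
    IsUnit (Γ.Z A B k k').det ∧
      ∃ R : Γ.Hilb →L[ℂ] Γ.Hilb, IsResolventAt (Γ.T A B) (k ^ 2) R ∧
        Γ.IsIntegralOperator R (Γ.kernel A B k k') := by
  have hZ := Γ.isUnit_det_Z hT hk hk' h hz
  have hsol : ∀ f : Γ.Hilb, ∃ u : (Γ.T A B).domain, Γ.T A B u - (k ^ 2) • (u : Γ.Hilb) = f ∧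
      ∀ j, (u : Γ.Hilb) j =ᵐ[volume.restrict (Γ.interval j)]
        fun x => ∑ j', ∫ y in Γ.interval j', Γ.kernel A B k k' j j' x y * f j' y := by
    intro f
    obtain ⟨u, hu, hk⟩ := Γ.exists_solution A B hk hk' h hZ f
    obtain ⟨hd, hT⟩ := Γ.exists_apply_eq_of_TRel hu
    exact ⟨⟨u, hd⟩, by rw [hT, add_sub_cancel_right], hk⟩
  obtain ⟨R, hR⟩ := exists_isResolventAt hT hz fun f => (hsol f).imp fun _ h => h.1
  refine ⟨hZ, R, hR, Γ.measurable_kernel A B k k', fun f => ⟨fun j j' =>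
    Filter.Eventually.of_forall fun x => Γ.integrable_kernel_mul A B hk hk' f j j' x, ?_⟩⟩
  obtain ⟨u, hu, hker⟩ := hsol f
  -- `R` inverts `T - k²` from the left, so `R f` is the explicit solution `u`.
  have := hR.2 u
  rw [hu] at this
  rw [this]
  exact hker

end SignedMetricGraph

/-! ### Square roots and conclusion -/

theorem exists_sq_eq_of_im_ne_zero {z : ℂ} (hz : z.im ≠ 0) :
    ∃ k ∈ quadrantQ ∪ quadrantP, k ^ 2 = z := by
  obtain ⟨k, hk⟩ := IsAlgClosed.exists_pow_nat_eq z (n := 2) (by norm_num)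
  have him : z.im = 2 * k.re * k.im := by rw [← hk, pow_two, Complex.mul_im]; ring
  have hre0 : k.re ≠ 0 := fun h => hz (by rw [him, h]; ring)
  have him0 : k.im ≠ 0 := fun h => hz (by rw [him, h]; ring)
  have key : ∀ k : ℂ, k.re ≠ 0 → 0 < k.im → k ∈ quadrantQ ∪ quadrantP := fun k h1 h2 =>
    h1.lt_or_gt.symm.imp (fun h => ⟨h, h2⟩) (fun h => ⟨h, h2⟩)
  rcases him0.lt_or_gt with h | h
  -- Of the two roots `±k`, neither on a coordinate axis, the one in the upper half plane is taken.
  · exact ⟨-k, key _ (by simpa using hre0) (by simpa using h), by rw [neg_sq, hk]⟩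
  · exact ⟨k, key _ hre0 h, hk⟩

end IndefiniteGraph

theorem proposition6p9 {V Ep Em Ip Im : Type*} [Finite V]
    [Fintype Ep] [Fintype Em] [Fintype Ip] [Fintype Im]
    [DecidableEq Ep] [DecidableEq Em] [DecidableEq Ip] [DecidableEq Im]
    (Γ : IndefiniteGraph.SignedMetricGraph V Ep Em Ip Im)
    (A B : Matrix (IndefiniteGraph.BIdx Ep Em Ip Im) (IndefiniteGraph.BIdx Ep Em Ip Im) ℂ)
    (hT : IsSelfAdjoint (Γ.T A B)) :
    (∀ z : ℂ, z.im ≠ 0 →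
      ∃ k ∈ IndefiniteGraph.quadrantQ ∪ IndefiniteGraph.quadrantP, k ^ 2 = z) ∧
    (∀ k ∈ IndefiniteGraph.quadrantQ,
      IsUnit (Γ.Z A B k (Complex.I * k)).det ∧
      ∃ R : Γ.Hilb →L[ℂ] Γ.Hilb, IndefiniteGraph.IsResolventAt (Γ.T A B) (k ^ 2) R ∧
        Γ.IsIntegralOperator R (Γ.kernel A B k (Complex.I * k))) ∧
    (∀ k ∈ IndefiniteGraph.quadrantP,
      IsUnit (Γ.Z A B k (-(Complex.I * k))).det ∧
      ∃ R : Γ.Hilb →L[ℂ] Γ.Hilb, IndefiniteGraph.IsResolventAt (Γ.T A B) (k ^ 2) R ∧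
        Γ.IsIntegralOperator R (Γ.kernel A B k (-(Complex.I * k)))) := by
  have hz : ∀ k : ℂ, k.re ≠ 0 → k.im ≠ 0 → (k ^ 2).im ≠ 0 := fun k h1 h2 => by
    have : (k ^ 2).im = 2 * k.re * k.im := by rw [pow_two, Complex.mul_im]; ring
    rw [this]
    exact mul_ne_zero (mul_ne_zero two_ne_zero h1) h2
  refine ⟨fun z => IndefiniteGraph.exists_sq_eq_of_im_ne_zero, fun k hk => ?_, fun k hk => ?_⟩
  -- `Im (ik) = Re k`, so the quadrant decides which of `±ik` has positive imaginary part.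
  · exact Γ.exists_resolvent_isIntegralOperator hT hk.2 (by simpa using hk.1)
      (by rw [mul_pow, Complex.I_sq]; ring) (hz k hk.1.ne' hk.2.ne')
  · exact Γ.exists_resolvent_isIntegralOperator hT hk.2 (by simpa using hk.1)
      (by rw [neg_sq, mul_pow, Complex.I_sq]; ring) (hz k hk.1.ne hk.2.ne')
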